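/- Theorem A. Let $D \subset \mathbb{R}^n$ be open, let $f : D \to \mathbb{R}^m$ be smooth, and let $\Sigma = \{(x, f(x)) : x \in D\} \subset \mathbb{R}^{n+m}$ be its graph. Put $c = 1$ if $m \le 2$ or $n \le 2$, and $c = \min(m-1, n-1)$ otherwise. Suppose that $\Sigma$ is minimal, i.e. its mean curvature vector vanishes identically, and that for every $x \in D$ $$\|df_x\| = \sup_{|V| = 1} |df_x(V)| \le \frac{\sqrt{1+c}-1}{\sqrt{c}} .$$ Then $\Sigma$ is stable: let $F : (-\delta, \delta) \times D \to \mathbb{R}^{n+m}$, $\delta > 0$, be any smooth map such that every $F_s = F(s, \cdot)$ is an immersion, $F_0(x) = (x, f(x))$ for $x \in D$, $F_s = F_0$ outside a compact set $K \subset D$ for all $s$, and the variation field $\partial F/\partial s|_{s=0}$ is normal to $\Sigma$. Then the volume $$s \mapsto \int_K \sqrt{\det\left(\langle \partial_i F_s, \partial_j F_s \rangle\right)_{i,j}} \, dx$$ is differentiable for $s$ near $0$ and twice differentiable at $s = 0$, and $$\frac{d^2}{ds^2}\Big|_{s=0} \int_K \sqrt{\det\left(\langle \partial_i F_s, \partial_j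 F_s \rangle\right)_{i,j}} \, dx \ge 0 .$$ -/

import Mathlib

open Set Filter Topology MeasureTheory
open scoped ContDiff

noncomputable section

namespace MinimalGraph

section Immersions

variable {n : ℕ} {W : Type*} [NormedAddCommGroup W] [InnerProductSpace ℝ W]

/-- The coordinate partial derivative `∂F/∂xⁱ` at `x`. -/
def partialD (F : EuclideanSpace ℝ (Fin n) → W) (i : Fin n) (x : EuclideanSpace ℝ (Fin n)) : W :=
  fderiv ℝ F x (EuclideanSpace.single i (1 : ℝ))

/-- The induced metric `g_ij = ⟨∂F/∂xⁱ, ∂F/∂xʲ⟩` of `F` at `x`. -/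
def inducedMetric (F : EuclideanSpace ℝ (Fin n) → W) (x : EuclideanSpace ℝ (Fin n)) :
    Matrix (Fin n) (Fin n) ℝ :=
  Matrix.of fun i j => inner ℝ (partialD F i x) (partialD F j x)

/-- The density `√det (g_ij)` of the induced volume form with respect to Lebesgue measure. -/
def volumeDensity (F : EuclideanSpace ℝ (Fin n) → W) (x : EuclideanSpace ℝ (Fin n)) : ℝ :=
  Real.sqrt (inducedMetric F x).det

/-- The `n`-dimensional volume of the part of the immersed submanifold `F` lying over `K`. -/
def volumeOver (K : Set (EuclideanSpace ℝ (Fin n))) (F : EuclideanSpace ℝ (Fin n) → W) : ℝ :=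
  ∫ x in K, volumeDensity F x

/-- The tangent space of the immersed submanifold `F` at `F x`, as a subspace of `W`. -/
def tangentSpaceAt (F : EuclideanSpace ℝ (Fin n) → W) (x : EuclideanSpace ℝ (Fin n)) :
    Submodule ℝ W :=
  LinearMap.range (fderiv ℝ F x : EuclideanSpace ℝ (Fin n) →ₗ[ℝ] W)

/-- The normal space of the immersed submanifold `F` at `F x`. -/
def normalSpaceAt (F : EuclideanSpace ℝ (Fin n) → W) (x : EuclideanSpace ℝ (Fin n)) :
    Submodule ℝ W :=
  (tangentSpaceAt F x)ᗮ

/-- The second fundamental form `(∂²F/∂xⁱ∂xʲ)^N` at `x`. -/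
def secondFundamentalForm [FiniteDimensional ℝ W] (F : EuclideanSpace ℝ (Fin n) → W)
    (i j : Fin n) (x : EuclideanSpace ℝ (Fin n)) : W :=
  (normalSpaceAt F x).starProjection (partialD (partialD F j) i x)

/-- The mean curvature vector `∑ g^{ij} (∂²F/∂xⁱ∂xʲ)^N` at `x`. -/
def meanCurvature [FiniteDimensional ℝ W] (F : EuclideanSpace ℝ (Fin n) → W)
    (x : EuclideanSpace ℝ (Fin n)) : W :=
  ∑ i, ∑ j, (inducedMetric F x)⁻¹ i j • secondFundamentalForm F i j x

/-- The submanifold parametrized by `F` over `D` is minimal: its mean curvature vanishes. -/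
def IsMinimal [FiniteDimensional ℝ W] (D : Set (EuclideanSpace ℝ (Fin n)))
    (F : EuclideanSpace ℝ (Fin n) → W) : Prop :=
  ∀ x ∈ D, meanCurvature F x = 0

/-- `F s`, `s ∈ (-δ, δ)`, is a smooth one-parameter family of immersions of `D` which equals `F₀`
at `s = 0` and, for every `s`, outside `K`, and whose variation field `∂F/∂s` at `s = 0` is
normal. -/
structure IsNormalVariation (D : Set (EuclideanSpace ℝ (Fin n)))
    (F₀ : EuclideanSpace ℝ (Fin n) → W) (K : Set (EuclideanSpace ℝ (Fin n))) (δ : ℝ)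
    (F : ℝ → EuclideanSpace ℝ (Fin n) → W) : Prop where
  smooth : ContDiffOn ℝ ∞ (fun p : ℝ × EuclideanSpace ℝ (Fin n) => F p.1 p.2) (Ioo (-δ) δ ×ˢ D)
  immersion : ∀ s ∈ Ioo (-δ) δ, ∀ x ∈ D, Function.Injective (fderiv ℝ (F s) x)
  initial : ∀ x ∈ D, F 0 x = F₀ x
  fixed_outside : ∀ s ∈ Ioo (-δ) δ, ∀ x ∈ D \ K, F s x = F₀ x
  normal : ∀ x ∈ D, deriv (fun s => F s x) 0 ∈ normalSpaceAt F₀ x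

/-- `A` is differentiable near `s₀` and its derivative has derivative `a` at `s₀`. -/
def HasSecondDerivAt (A : ℝ → ℝ) (a s₀ : ℝ) : Prop :=
  (∀ᶠ s in 𝓝 s₀, DifferentiableAt ℝ A s) ∧ HasDerivAt (deriv A) a s₀

/-- The submanifold parametrized by `F₀` over `D` is stable: for every normal variation supported
in a compact subset `K` of `D`, the volume (over `K`, as it does not change elsewhere) has a second
derivative at `s = 0`, and this is nonnegative. -/
def IsStable (D : Set (EuclideanSpace ℝ (Fin n))) (F₀ : EuclideanSpace ℝ (Fin n) → W) : Prop :=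
  ∀ K : Set (EuclideanSpace ℝ (Fin n)), IsCompact K → K ⊆ D →
    ∀ δ : ℝ, 0 < δ → ∀ F : ℝ → EuclideanSpace ℝ (Fin n) → W, IsNormalVariation D F₀ K δ F →
      ∃ a : ℝ, HasSecondDerivAt (fun s => volumeOver K (F s)) a 0 ∧ 0 ≤ a

end Immersions

/-- The parametrization `x ↦ (x, f x)` of the graph of `f`, with values in the Euclidean space
`ℝⁿ⁺ᵐ` whose coordinates are those of `ℝⁿ` followed by those of `ℝᵐ`. -/
def graphMap {n m : ℕ} (f : EuclideanSpace ℝ (Fin n) → EuclideanSpace ℝ (Fin m))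
    (x : EuclideanSpace ℝ (Fin n)) : EuclideanSpace ℝ (Fin n ⊕ Fin m) :=
  WithLp.toLp 2 (Sum.elim (fun i => x i) (fun j => f x j))

/-- The constant `c`: `1` if `m ≤ 2` or `n ≤ 2`, and `min (m - 1) (n - 1)` otherwise. -/
def stabilityConst (n m : ℕ) : ℝ :=
  if m ≤ 2 ∨ n ≤ 2 then 1 else min ((m : ℝ) - 1) ((n : ℝ) - 1)

end MinimalGraph

end

/-! The proof is a convexity argument: a minimal graph whose slopes are bounded by some `t < 1`
locally minimizes volume, so the second derivative cannot be negative. The constant `c` enters only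
through `(√(1+c) - 1)/√c < 1`.

The area integrand `P ↦ √det(1 + PᵀP)` is not convex on all matrices, but on the convex set of
contractions even its logarithm is convex (`IsContr.trace_nonneg`). Hence it lies above its tangent
planes there (`IsContr.sqrt_det_graphGram_ge`). Integrating this inequality over `K` between `df`
and `dh`, where `h = f` off `K`, leaves a linear term. That term is the first variation of area. It
vanishes because minimality can be written in divergence form (`IsMinimal.sum_fderiv_areaFlux`). So
a minimal graph of a contraction has least area among graphs of contractions with the same boundary
values (`IsMinimal.setIntegral_area_le`).

A variation `F s` need not be parametrized as a graph. For small `s`, however, it is `C¹`-close to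
the original parametrization, so its horizontal part is a diffeomorphism preserving `K`. Undoing
this reparametrization gives a graph whose slopes still do not exceed 1, because `t < 1` leaves room
(`IsMinimal.volumeOver_le`). Volume does not depend on the parametrization, so `s = 0` is a local
minimum. Differentiation under the integral supplies the second derivative. -/

set_option linter.unusedSectionVars false

noncomputable section

namespace MinimalGraph

/-! ### Derivatives of determinants and inverse matrices. -/

section MatrixCalculus

variable {ι : Type*} [Fintype ι] [DecidableEq ι] {E : Type*} [NormedAddCommGroup E] [NormedSpace ℝ E]

theorem contDiffAt_det {A : E → Matrix ι ι ℝ} {x : E} {k : WithTop ℕ∞}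
    (hA : ∀ i j, ContDiffAt ℝ k (fun y => A y i j) x) :
    ContDiffAt ℝ k (fun y => (A y).det) x := by
  simp only [Matrix.det_apply']
  exact ContDiffAt.sum fun σ _ => contDiffAt_const.mul (contDiffAt_prod fun i _ => hA _ _)

theorem contDiffAt_adjugate {A : E → Matrix ι ι ℝ} {x : E} {k : WithTop ℕ∞}
    (hA : ∀ i j, ContDiffAt ℝ k (fun y => A y i j) x) (i j : ι) :
    ContDiffAt ℝ k (fun y => (A y).adjugate i j) x := by
  simp only [Matrix.adjugate_apply]
  refine contDiffAt_det fun a b => ?_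
  by_cases h : a = j
  · subst h
    simpa using contDiffAt_const
  · simpa [Matrix.updateRow_ne h] using hA a b

theorem contDiffAt_matrix_inv {A : E → Matrix ι ι ℝ} {x : E} {k : WithTop ℕ∞}
    (hA : ∀ i j, ContDiffAt ℝ k (fun y => A y i j) x) (hx : (A x).det ≠ 0) (i j : ι) :
    ContDiffAt ℝ k (fun y => (A y)⁻¹ i j) x := by
  simp only [Matrix.inv_def, Matrix.smul_apply, Ring.inverse_eq_inv', smul_eq_mul]
  exact ((contDiffAt_det hA).inv hx).mul (contDiffAt_adjugate hA i j)

/-- Cramer's rule for each diagonal entry. The right-hand side is the form in which the product rule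
produces the derivative of a determinant. -/
theorem trace_adjugate_mul (A B : Matrix ι ι ℝ) :
    (A.adjugate * B).trace = ∑ i, (A.updateCol i fun k => B k i).det := by
  refine Finset.sum_congr rfl fun i _ => ?_
  rw [← Matrix.cramer_apply, Matrix.cramer_eq_adjugate_mulVec]
  rfl

theorem hasDerivAt_det {A : ℝ → Matrix ι ι ℝ} {A' : Matrix ι ι ℝ} {t : ℝ}
    (hA : ∀ i j, HasDerivAt (fun s => A s i j) (A' i j) t) :
    HasDerivAt (fun s => (A s).det) (((A t).adjugate * A').trace) t := by
  simp only [Matrix.det_apply', trace_adjugate_mul]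
  have : HasDerivAt (fun s => ∑ σ : Equiv.Perm ι, ((Equiv.Perm.sign σ : ℤ) : ℝ) *
      ∏ i, A s (σ i) i) (∑ σ : Equiv.Perm ι, ((Equiv.Perm.sign σ : ℤ) : ℝ) *
        ∑ i, (∏ j ∈ Finset.univ.erase i, A t (σ j) j) * A' (σ i) i) t := by
    refine HasDerivAt.fun_sum fun σ _ => HasDerivAt.const_mul _ ?_
    simpa using HasDerivAt.fun_finsetProd (u := Finset.univ) fun i _ => hA (σ i) i
  convert this using 1
  rw [Finset.sum_comm]
  refine Finset.sum_congr rfl fun σ _ => ?_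
  rw [Finset.mul_sum]
  refine Finset.sum_congr rfl fun i _ => ?_
  congr 1
  rw [← Finset.mul_prod_erase _ _ (Finset.mem_univ i), mul_comm]
  congr 1
  · refine Finset.prod_congr rfl fun j hj => ?_
    rw [Matrix.updateCol_ne (Finset.ne_of_mem_erase hj)]
  · simp

theorem hasDerivAt_det' {A : ℝ → Matrix ι ι ℝ} {A' : Matrix ι ι ℝ} {t : ℝ}
    (hA : ∀ i j, HasDerivAt (fun s => A s i j) (A' i j) t) (ht : (A t).det ≠ 0) :
    HasDerivAt (fun s => (A s).det) ((A t).det * ((A t)⁻¹ * A').trace) t := by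
  convert hasDerivAt_det hA using 1
  rw [Matrix.inv_def, Ring.inverse_eq_inv', Matrix.smul_mul, Matrix.trace_smul, smul_eq_mul,
    mul_inv_cancel_left₀ ht]

/-- Differentiability comes from the adjugate formula; the value then follows by differentiating `A
* A⁻¹ = 1`, which holds near `t`. -/
theorem hasDerivAt_matrix_inv {A : ℝ → Matrix ι ι ℝ} {A' : Matrix ι ι ℝ} {t : ℝ}
    (hA : ∀ i j, HasDerivAt (fun s => A s i j) (A' i j) t)
    (hc : ∀ i j, ContDiffAt ℝ 1 (fun s => A s i j) t) (ht : (A t).det ≠ 0) (i j : ι) :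
    HasDerivAt (fun s => (A s)⁻¹ i j) ((-((A t)⁻¹ * A' * (A t)⁻¹)) i j) t := by
  have hd : ∀ i j, DifferentiableAt ℝ (fun s => (A s)⁻¹ i j) t := fun i j =>
    (contDiffAt_matrix_inv hc ht i j).differentiableAt one_ne_zero
  set B : Matrix ι ι ℝ := Matrix.of fun i j => deriv (fun s => (A s)⁻¹ i j) t with hB
  have hunit : IsUnit (A t).det := isUnit_iff_ne_zero.2 ht
  have key : A' * (A t)⁻¹ + A t * B = 0 := by
    ext a b
    have h1 : HasDerivAt (fun s => (A s * (A s)⁻¹) a b) ((A' * (A t)⁻¹ + A t * B) a b) t := by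
      simp only [Matrix.mul_apply, Matrix.add_apply, ← Finset.sum_add_distrib]
      exact HasDerivAt.fun_sum fun k _ => (hA a k).mul (hd k b).hasDerivAt
    have h2 : (fun s => (A s * (A s)⁻¹) a b) =ᶠ[𝓝 t] fun _ => (1 : Matrix ι ι ℝ) a b := by
      filter_upwards [(contDiffAt_det hc).continuousAt.eventually_ne ht] with s hs
      rw [Matrix.mul_nonsing_inv _ (isUnit_iff_ne_zero.2 hs)]
    exact h1.unique ((hasDerivAt_const t _).congr_of_eventuallyEq h2)
  have hBeq : B = -((A t)⁻¹ * A' * (A t)⁻¹) := by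
    have h := congrArg (fun M => (A t)⁻¹ * M) key
    simp only [Matrix.mul_add, Matrix.mul_zero, ← Matrix.mul_assoc,
      Matrix.nonsing_inv_mul _ hunit, Matrix.one_mul] at h
    exact eq_neg_of_add_eq_zero_right h
  rw [← hBeq]
  exact (hd i j).hasDerivAt

end MatrixCalculus

/-! ### Convexity of the area integrand on contractions. -/

section Convexity

open Matrix

variable {m n : Type*} [Fintype m] [DecidableEq m] [Fintype n] [DecidableEq n]

/-- The metric `1 + PᵀP` induced on the graph of the linear map with matrix `P`. -/
def graphGram (P : Matrix m n ℝ) : Matrix n n ℝ := 1 + Pᵀ * P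

/-- The linear maps of operator norm at most one, described by their matrices. -/
def IsContr (P : Matrix m n ℝ) : Prop := (1 - Pᵀ * P).PosSemidef

theorem graphGram_posDef (P : Matrix m n ℝ) : (graphGram P).PosDef :=
  Matrix.PosDef.one.add_posSemidef (by simpa using posSemidef_conjTranspose_mul_self P)

theorem graphGram_det_pos (P : Matrix m n ℝ) : 0 < (graphGram P).det := (graphGram_posDef P).det_pos

theorem graphGram_transpose (P : Matrix m n ℝ) : (graphGram P)ᵀ = graphGram P := by
  simp [graphGram]

theorem graphGram_inv_mul (P : Matrix m n ℝ) : (graphGram P)⁻¹ * graphGram P = 1 :=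
  nonsing_inv_mul _ (isUnit_iff_ne_zero.2 (graphGram_det_pos P).ne')

theorem graphGram_mul_inv (P : Matrix m n ℝ) : graphGram P * (graphGram P)⁻¹ = 1 :=
  mul_nonsing_inv _ (isUnit_iff_ne_zero.2 (graphGram_det_pos P).ne')

/-- The push-through identity, from `Pᵀ(1 + PPᵀ) = (1 + PᵀP)Pᵀ`. It moves `P` past the inverse
metrics in the trace computations below. -/
theorem graphGram_inv_mul_transpose (P : Matrix m n ℝ) :
    (graphGram P)⁻¹ * Pᵀ = Pᵀ * (graphGram Pᵀ)⁻¹ := by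
  have h : Pᵀ * graphGram Pᵀ = graphGram P * Pᵀ := by
    simp [graphGram, Matrix.mul_add, Matrix.add_mul, Matrix.mul_assoc]
  calc (graphGram P)⁻¹ * Pᵀ = (graphGram P)⁻¹ * Pᵀ * (graphGram Pᵀ * (graphGram Pᵀ)⁻¹) := by
        rw [graphGram_mul_inv, Matrix.mul_one]
    _ = (graphGram P)⁻¹ * (Pᵀ * graphGram Pᵀ) * (graphGram Pᵀ)⁻¹ := by
        simp only [Matrix.mul_assoc]
    _ = Pᵀ * (graphGram Pᵀ)⁻¹ := by
        rw [h, ← Matrix.mul_assoc (graphGram P)⁻¹, graphGram_inv_mul, Matrix.one_mul]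

theorem mul_graphGram_inv_mul_transpose (P : Matrix m n ℝ) :
    P * (graphGram P)⁻¹ * Pᵀ = 1 - (graphGram Pᵀ)⁻¹ := by
  rw [Matrix.mul_assoc, graphGram_inv_mul_transpose, ← Matrix.mul_assoc]
  have h : P * Pᵀ = graphGram Pᵀ - 1 := by simp [graphGram]
  rw [h, Matrix.sub_mul, graphGram_mul_inv, Matrix.one_mul]

/-- Singular values are avoided by writing `1 - PPᵀ = (1 - PPᵀ)² + P(1 - PᵀP)Pᵀ`, a sum of two
positive semidefinite matrices. -/
theorem IsContr.transpose {P : Matrix m n ℝ} (hP : IsContr P) : IsContr Pᵀ := by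
  have h : 1 - Pᵀᵀ * Pᵀ = (1 - P * Pᵀ)ᴴ * (1 - P * Pᵀ) + P * (1 - Pᵀ * P) * Pᴴ := by
    simp only [conjTranspose_eq_transpose_of_trivial, transpose_sub, transpose_mul,
      transpose_transpose, transpose_one]
    simp only [Matrix.mul_sub, Matrix.sub_mul, Matrix.mul_one, Matrix.one_mul, Matrix.mul_assoc]
    abel
  rw [IsContr, h]
  exact (posSemidef_conjTranspose_mul_self _).add (hP.mul_mul_conjTranspose_same P)

/-- The eigenvalues of `(1 + PᵀP)⁻¹` are at least `1/2` when the singular values of `P` are at most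
1. With `G = 1 + PᵀP`, the matrix is `G⁻¹(2G - G²)G⁻¹`, and `2G - G² = 1 - (PᵀP)²` splits as `(1 -
PᵀP) + Pᵀ(1 - PPᵀ)P`. -/
theorem IsContr.two_inv_sub_one {P : Matrix m n ℝ} (hP : IsContr P) :
    ((graphGram P)⁻¹ - (1 - (graphGram P)⁻¹)).PosSemidef := by
  have hT : ((graphGram P)⁻¹)ᴴ = (graphGram P)⁻¹ := by
    rw [conjTranspose_eq_transpose_of_trivial, transpose_nonsing_inv, graphGram_transpose]
  have h : (graphGram P)⁻¹ - (1 - (graphGram P)⁻¹) =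
      (graphGram P)⁻¹ * ((1 - Pᵀ * P) + Pᵀ * (1 - Pᵀᵀ * Pᵀ) * Pᵀᴴ) * ((graphGram P)⁻¹)ᴴ := by
    have h2 : (1 - Pᵀ * P) + Pᵀ * (1 - Pᵀᵀ * Pᵀ) * Pᵀᴴ =
        graphGram P + graphGram P - graphGram P * graphGram P := by
      simp only [conjTranspose_eq_transpose_of_trivial, transpose_transpose, graphGram]
      simp only [Matrix.mul_sub, Matrix.sub_mul, Matrix.mul_one, Matrix.one_mul, Matrix.mul_assoc,
        Matrix.mul_add, Matrix.add_mul]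
      abel
    rw [h2, hT, Matrix.mul_sub, Matrix.mul_add, ← Matrix.mul_assoc, graphGram_inv_mul,
      Matrix.one_mul, Matrix.sub_mul, graphGram_mul_inv, Matrix.add_mul, Matrix.one_mul]
    abel
  rw [h]
  exact (hP.add (hP.transpose.mul_mul_conjTranspose_same _)).mul_mul_conjTranspose_same _

open scoped MatrixOrder in
theorem trace_mul_mul_mul_nonneg {A : Matrix m m ℝ} {B : Matrix n n ℝ} (hA : A.PosSemidef)
    (hB : B.PosSemidef) (Q : Matrix m n ℝ) : 0 ≤ (A * Q * B * Qᵀ).trace := by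
  obtain ⟨C, rfl⟩ := CStarAlgebra.nonneg_iff_eq_star_mul_self.mp hA.nonneg
  rw [star_eq_conjTranspose, Matrix.mul_assoc Cᴴ, Matrix.mul_assoc Cᴴ, Matrix.mul_assoc Cᴴ,
    trace_mul_comm]
  have := ((hB.mul_mul_conjTranspose_same Q).mul_mul_conjTranspose_same C).trace_nonneg
  simpa [Matrix.mul_assoc] using this

/-- The quantity is half the second derivative of `log det(1 + PᵀP)` in the direction `Q`. With `g =
(1 + PᵀP)⁻¹` and `h = (1 + PPᵀ)⁻¹` it equals `S - T`, where `S = tr(hQgQᵀ)` and `T = tr(gPᵀQgPᵀQ)`.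
Put `U = tr((1-h)Q(1-g)Qᵀ)`. Positivity of the form `S` at `Q - PQᵀP` reads `S - 2T + U ≥ 0`. Since
`1-h ≤ h` and `1-g ≤ g` for contractions, `U ≤ S`. Together these give `T ≤ S`. -/
theorem IsContr.trace_nonneg {P : Matrix m n ℝ} (hP : IsContr P) (Q : Matrix m n ℝ) :
    0 ≤ ((graphGram P)⁻¹ * (Qᵀ * Q)).trace -
      ((graphGram P)⁻¹ * (Pᵀ * Q + Qᵀ * P) * (graphGram P)⁻¹ * (Pᵀ * Q)).trace := by
  set g := (graphGram P)⁻¹ with hg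
  set h := (graphGram Pᵀ)⁻¹ with hh
  have hgT : gᵀ = g := by rw [hg, transpose_nonsing_inv, graphGram_transpose]
  have hhT : hᵀ = h := by rw [hh, transpose_nonsing_inv, graphGram_transpose]
  have hgpos : g.PosSemidef := (graphGram_posDef P).inv.posSemidef
  have hhpos : h.PosSemidef := (graphGram_posDef Pᵀ).inv.posSemidef
  have e1 : g * Pᵀ = Pᵀ * h := graphGram_inv_mul_transpose P
  have e1' : P * g = h * P := by simpa [hgT, hhT] using congrArg Matrix.transpose e1
  have e2 : P * g * Pᵀ = 1 - h := mul_graphGram_inv_mul_transpose P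
  have e3 : Pᵀ * h * P = 1 - g := by
    simpa [hg, hh] using mul_graphGram_inv_mul_transpose Pᵀ
  set S := (h * Q * g * Qᵀ).trace with hS
  set T := (g * (Pᵀ * Q) * g * (Pᵀ * Q)).trace with hT
  have f1 : (g * (Qᵀ * Q)).trace - (g * (Pᵀ * Q + Qᵀ * P) * g * (Pᵀ * Q)).trace = S - T := by
    have a1 : (g * (Qᵀ * Q)).trace = (Q * g * Qᵀ).trace := by
      rw [← Matrix.mul_assoc, trace_mul_comm, Matrix.mul_assoc]
    have a2 : (g * (Qᵀ * P) * g * (Pᵀ * Q)).trace = ((1 - h) * (Q * g * Qᵀ)).trace := by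
      rw [show g * (Qᵀ * P) * g * (Pᵀ * Q) = (g * Qᵀ) * (P * g * Pᵀ * Q) by
        simp only [Matrix.mul_assoc], e2, trace_mul_comm]
      simp only [Matrix.mul_assoc]
    rw [Matrix.mul_add, Matrix.add_mul, Matrix.add_mul, trace_add, a1, a2, Matrix.sub_mul,
      trace_sub, Matrix.one_mul, hS, hT]
    simp only [Matrix.mul_assoc]
    ring
  have f2 : 0 ≤ (h * (Q - P * Qᵀ * P) * g * (Q - P * Qᵀ * P)ᵀ).trace :=
    trace_mul_mul_mul_nonneg hhpos hgpos _
  have f3 : (h * (Q - P * Qᵀ * P) * g * (Q - P * Qᵀ * P)ᵀ).trace =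
      S - 2 * T + ((1 - h) * Q * (1 - g) * Qᵀ).trace := by
    have b1 : (h * (P * Qᵀ * P) * g * Qᵀ).trace = T := by
      rw [← trace_transpose, hT]
      rw [show (h * (P * Qᵀ * P) * g * Qᵀ)ᵀ = Q * (g * Pᵀ * Q * (Pᵀ * h)) by
        simp only [transpose_mul, hgT, hhT, transpose_transpose, Matrix.mul_assoc], ← e1,
        trace_mul_comm, show g * Pᵀ * Q * (g * Pᵀ) * Q = g * (Pᵀ * Q) * g * (Pᵀ * Q) by
          simp only [Matrix.mul_assoc]]
    have b2 : (h * Q * g * (P * Qᵀ * P)ᵀ).trace = T := by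
      rw [show h * Q * g * (P * Qᵀ * P)ᵀ = h * Q * g * Pᵀ * Q * Pᵀ by
        simp only [transpose_mul, transpose_transpose, Matrix.mul_assoc], trace_mul_comm,
        show Pᵀ * (h * Q * g * Pᵀ * Q) = Pᵀ * h * Q * g * Pᵀ * Q by
          simp only [Matrix.mul_assoc], ← e1, hT]
      simp only [Matrix.mul_assoc]
    have b3 : (h * (P * Qᵀ * P) * g * (P * Qᵀ * P)ᵀ).trace =
        ((1 - h) * Q * (1 - g) * Qᵀ).trace := by
      rw [← e2, ← e3, show h * (P * Qᵀ * P) * g * (P * Qᵀ * P)ᵀ =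
        h * P * Qᵀ * (P * g * Pᵀ * Q * Pᵀ) by
        simp only [transpose_mul, transpose_transpose, Matrix.mul_assoc], trace_mul_comm]
      simp only [Matrix.mul_assoc]
    simp only [transpose_sub, Matrix.mul_sub, Matrix.sub_mul, trace_sub] at b1 b2 b3 ⊢
    rw [b1, b2, b3]
    ring
  have f4 : 0 ≤ ((h - (1 - h)) * Q * g * Qᵀ).trace :=
    trace_mul_mul_mul_nonneg hP.transpose.two_inv_sub_one hgpos Q
  have f5 : 0 ≤ ((1 - h) * Q * (g - (1 - g)) * Qᵀ).trace := by
    refine trace_mul_mul_mul_nonneg ?_ hP.two_inv_sub_one Q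
    rw [← e2]
    exact hgpos.mul_mul_conjTranspose_same P
  have f6 : ((h - (1 - h)) * Q * g * Qᵀ).trace + ((1 - h) * Q * (g - (1 - g)) * Qᵀ).trace =
      S - ((1 - h) * Q * (1 - g) * Qᵀ).trace := by
    rw [hS]
    simp only [Matrix.mul_sub, Matrix.sub_mul, Matrix.one_mul, Matrix.mul_one, trace_sub]
    ring
  linarith

/-- The contractions form a convex set: the defect of `t ↦ PᵀP` from being affine along the segment
is the positive term `t(1-t)(R-P)ᵀ(R-P)`. -/
theorem IsContr.add_smul_sub {P R : Matrix m n ℝ} (hP : IsContr P) (hR : IsContr R) {t : ℝ}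
    (h0 : 0 ≤ t) (h1 : t ≤ 1) : IsContr (P + t • (R - P)) := by
  have h : 1 - (P + t • (R - P))ᵀ * (P + t • (R - P)) =
      (1 - t) • (1 - Pᵀ * P) + t • (1 - Rᵀ * R) + (t * (1 - t)) • ((R - P)ᴴ * (R - P)) := by
    simp only [conjTranspose_eq_transpose_of_trivial, transpose_add, transpose_sub,
      transpose_smul, Matrix.mul_sub, Matrix.sub_mul, Matrix.mul_add, Matrix.add_mul,
      Matrix.smul_mul, Matrix.mul_smul, smul_sub]
    module
  rw [IsContr, h]
  exact ((PosSemidef.smul hP (sub_nonneg.2 h1)).add (PosSemidef.smul hR h0)).add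
    (PosSemidef.smul (posSemidef_conjTranspose_mul_self _) (mul_nonneg h0 (sub_nonneg.2 h1)))

theorem hasDerivAt_log_det_graphGram (P Q : Matrix m n ℝ) (t : ℝ) :
    HasDerivAt (fun t : ℝ => Real.log (graphGram (P + t • Q)).det)
      (2 * ((graphGram (P + t • Q))⁻¹ * ((P + t • Q)ᵀ * Q)).trace) t ∧
    HasDerivAt (fun t : ℝ => 2 * ((graphGram (P + t • Q))⁻¹ * ((P + t • Q)ᵀ * Q)).trace)
      (2 * (((graphGram (P + t • Q))⁻¹ * (Qᵀ * Q)).trace -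
      ((graphGram (P + t • Q))⁻¹ * ((P + t • Q)ᵀ * Q + Qᵀ * (P + t • Q)) *
        (graphGram (P + t • Q))⁻¹ * ((P + t • Q)ᵀ * Q)).trace)) t := by
  set R := P + t • Q with hR
  have hP : ∀ a b, HasDerivAt (fun s : ℝ => (P + s • Q) a b) (Q a b) t := fun a b => by
    simpa using ((hasDerivAt_id t).mul_const (Q a b)).const_add (P a b)
  have hPQ : ∀ i j, HasDerivAt (fun s : ℝ => ((P + s • Q)ᵀ * Q) i j) ((Qᵀ * Q) i j) t := by
    intro i j
    simp only [Matrix.mul_apply, transpose_apply]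
    exact HasDerivAt.fun_sum fun k _ => (hP k i).mul_const _
  have hG : ∀ i j, HasDerivAt (fun s : ℝ => graphGram (P + s • Q) i j)
      ((Rᵀ * Q + Qᵀ * R) i j) t := by
    intro i j
    have h : HasDerivAt (fun s : ℝ => (1 : Matrix n n ℝ) i j +
        ∑ k, (P + s • Q) k i * (P + s • Q) k j) (∑ k, (Q k i * R k j + R k i * Q k j)) t :=
      HasDerivAt.const_add _ (HasDerivAt.fun_sum fun k _ => (hP k i).mul (hP k j))
    refine h.congr_deriv ?_
    rw [Matrix.add_apply, Matrix.mul_apply, Matrix.mul_apply, ← Finset.sum_add_distrib]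
    exact Finset.sum_congr rfl fun k _ => add_comm _ _
  have hGc : ∀ i j, ContDiffAt ℝ 1 (fun s : ℝ => graphGram (P + s • Q) i j) t := by
    intro i j
    simp only [graphGram, Matrix.add_apply, Matrix.mul_apply, transpose_apply, Matrix.smul_apply,
      smul_eq_mul]
    fun_prop
  have hdet := (graphGram_det_pos R).ne'
  constructor
  · convert (hasDerivAt_det' hG hdet).log hdet using 1
    rw [mul_div_cancel_left₀ _ hdet, Matrix.mul_add, trace_add, two_mul]
    congr 1
    rw [← trace_transpose]
    simp only [transpose_mul, transpose_nonsing_inv, graphGram_transpose, transpose_transpose]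
    rw [trace_mul_comm]
  · refine HasDerivAt.const_mul 2 ?_
    have := fun i j => hasDerivAt_matrix_inv hG hGc hdet i j
    have h3 : HasDerivAt (fun s : ℝ => ((graphGram (P + s • Q))⁻¹ * ((P + s • Q)ᵀ * Q)).trace)
        ((-((graphGram R)⁻¹ * (Rᵀ * Q + Qᵀ * R) * (graphGram R)⁻¹)) * (Rᵀ * Q) +
          (graphGram R)⁻¹ * (Qᵀ * Q)).trace t := by
      simp only [Matrix.trace, Matrix.diag_apply]
      refine HasDerivAt.fun_sum fun i _ => ?_
      rw [Matrix.add_apply, Matrix.mul_apply, Matrix.mul_apply, ← Finset.sum_add_distrib]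
      simp_rw [Matrix.mul_apply (M := (graphGram _)⁻¹)]
      exact HasDerivAt.fun_sum fun j _ => (this i j).mul (hPQ j i)
    refine h3.congr_deriv ?_
    rw [trace_add, Matrix.neg_mul, trace_neg]
    ring

/-- The area integrand lies above its tangent planes at contractions. -/
theorem IsContr.sqrt_det_graphGram_ge {P R : Matrix m n ℝ} (hP : IsContr P) (hR : IsContr R) :
    √(graphGram P).det * (1 + ((graphGram P)⁻¹ * (Pᵀ * (R - P))).trace) ≤
      √(graphGram R).det := by
  have hd := hasDerivAt_log_det_graphGram P (R - P)
  have hconv : ConvexOn ℝ (Icc (0 : ℝ) 1)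
      (fun t : ℝ => Real.log (graphGram (P + t • (R - P))).det) := by
    refine convexOn_of_hasDerivWithinAt2_nonneg (convex_Icc 0 1)
      (fun t _ => (hd t).1.continuousAt.continuousWithinAt)
      (fun t _ => (hd t).1.hasDerivWithinAt) (fun t _ => (hd t).2.hasDerivWithinAt) fun t ht => ?_
    rw [interior_Icc] at ht
    have := (hP.add_smul_sub hR ht.1.le ht.2.le).trace_nonneg (R - P)
    linarith
  have h := hconv.le_slope_of_hasDerivAt (left_mem_Icc.2 zero_le_one) (right_mem_Icc.2 zero_le_one)
    zero_lt_one (hd 0).1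
  simp only [slope_def_field, zero_smul, add_zero, one_smul, add_sub_cancel, sub_zero,
    div_one] at h
  set τ := ((graphGram P)⁻¹ * (Pᵀ * (R - P))).trace
  have hPpos := graphGram_det_pos P
  have hRpos := graphGram_det_pos R
  have hsP := Real.sqrt_pos.2 hPpos
  have hsR := Real.sqrt_pos.2 hRpos
  have h2 : Real.log √(graphGram P).det + τ ≤ Real.log √(graphGram R).det := by
    rw [Real.log_sqrt hPpos.le, Real.log_sqrt hRpos.le]
    linarith
  -- Convexity of the logarithm gives the factor `exp τ`, which is weakened to its tangent `1 + τ`.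
  calc √(graphGram P).det * (1 + τ) ≤ √(graphGram P).det * Real.exp τ := by
        gcongr
        linarith [Real.add_one_le_exp τ]
    _ = Real.exp (Real.log √(graphGram P).det + τ) := by rw [Real.exp_add, Real.exp_log hsP]
    _ ≤ Real.exp (Real.log √(graphGram R).det) := Real.exp_le_exp.2 h2
    _ = √(graphGram R).det := Real.exp_log hsR

end Convexity

/-! ### The minimal surface system, in nondivergence and divergence form. -/

section Jacobian

variable {n m : ℕ} {ι : Type*} [Fintype ι] {k : WithTop ℕ∞}

/-- The Jacobian matrix of a map between Euclidean spaces. -/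
def jacobian (F : EuclideanSpace ℝ (Fin n) → EuclideanSpace ℝ ι) (x : EuclideanSpace ℝ (Fin n)) :
    Matrix ι (Fin n) ℝ :=
  Matrix.of fun a i => partialD F i x a

theorem fderiv_apply_coord {E : Type*} [NormedAddCommGroup E] [NormedSpace ℝ E]
    {F : E → EuclideanSpace ℝ ι} {x : E} (hF : DifferentiableAt ℝ F x) (v : E) (a : ι) :
    (fderiv ℝ F x v) a = fderiv ℝ (fun y => F y a) x v :=
  (congrArg (fun L : E →L[ℝ] ℝ => L v)
    ((EuclideanSpace.proj a : EuclideanSpace ℝ ι →L[ℝ] ℝ).hasFDerivAt.comp x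
      hF.hasFDerivAt).fderiv).symm

theorem inducedMetric_eq_transpose_mul (F : EuclideanSpace ℝ (Fin n) → EuclideanSpace ℝ ι)
    (x : EuclideanSpace ℝ (Fin n)) :
    inducedMetric F x = (jacobian F x).transpose * jacobian F x := by
  ext i j
  simp [inducedMetric, jacobian, Matrix.mul_apply, PiLp.inner_apply, mul_comm]

theorem contDiffAt_graphMap {f : EuclideanSpace ℝ (Fin n) → EuclideanSpace ℝ (Fin m)}
    {x : EuclideanSpace ℝ (Fin n)} (hf : ContDiffAt ℝ k f x) : ContDiffAt ℝ k (graphMap f) x := by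
  rw [contDiffAt_piLp]
  rintro (i | j)
  · exact (EuclideanSpace.proj i : EuclideanSpace ℝ (Fin n) →L[ℝ] ℝ).contDiff.contDiffAt
  · exact (EuclideanSpace.proj j : EuclideanSpace ℝ (Fin m) →L[ℝ] ℝ).contDiff.contDiffAt.comp x hf

theorem fderiv_graphMap_inl {f : EuclideanSpace ℝ (Fin n) → EuclideanSpace ℝ (Fin m)}
    {x : EuclideanSpace ℝ (Fin n)} (hf : ContDiffAt ℝ 1 f x) (v : EuclideanSpace ℝ (Fin n))
    (i : Fin n) : (fderiv ℝ (graphMap f) x v) (Sum.inl i) = v i := by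
  rw [fderiv_apply_coord ((contDiffAt_graphMap hf).differentiableAt one_ne_zero)]
  exact congrArg (fun L : EuclideanSpace ℝ (Fin n) →L[ℝ] ℝ => L v)
    (EuclideanSpace.proj i : EuclideanSpace ℝ (Fin n) →L[ℝ] ℝ).hasFDerivAt.fderiv

theorem fderiv_graphMap_inr {f : EuclideanSpace ℝ (Fin n) → EuclideanSpace ℝ (Fin m)}
    {x : EuclideanSpace ℝ (Fin n)} (hf : ContDiffAt ℝ 1 f x) (v : EuclideanSpace ℝ (Fin n))
    (a : Fin m) : (fderiv ℝ (graphMap f) x v) (Sum.inr a) = fderiv ℝ f x v a := by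
  rw [fderiv_apply_coord ((contDiffAt_graphMap hf).differentiableAt one_ne_zero),
    fderiv_apply_coord (hf.differentiableAt one_ne_zero)]
  rfl

theorem inducedMetric_graphMap {f : EuclideanSpace ℝ (Fin n) → EuclideanSpace ℝ (Fin m)}
    {x : EuclideanSpace ℝ (Fin n)} (hf : ContDiffAt ℝ 1 f x) :
    inducedMetric (graphMap f) x = graphGram (jacobian f x) := by
  ext i j
  rw [inducedMetric_eq_transpose_mul]
  simp only [Matrix.mul_apply, Fintype.sum_sum_type, graphGram, Matrix.add_apply,
    Matrix.transpose_apply, jacobian, Matrix.of_apply, partialD, fderiv_graphMap_inl hf,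
    fderiv_graphMap_inr hf]
  simp [Matrix.one_apply, eq_comm]

theorem contDiffAt_partialD {W : Type*} [NormedAddCommGroup W] [InnerProductSpace ℝ W]
    {F : EuclideanSpace ℝ (Fin n) → W} {x : EuclideanSpace ℝ (Fin n)} (hF : ContDiffAt ℝ ∞ F x)
    (i : Fin n) : ContDiffAt ℝ ∞ (partialD F i) x :=
  (hF.fderiv_right (m := ∞) (by simp)).clm_apply contDiffAt_const

theorem contDiffAt_jacobian {F : EuclideanSpace ℝ (Fin n) → EuclideanSpace ℝ ι}
    {x : EuclideanSpace ℝ (Fin n)} (hF : ContDiffAt ℝ ∞ F x) (a : ι) (i : Fin n) :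
    ContDiffAt ℝ ∞ (fun y => jacobian F y a i) x :=
  (contDiffAt_piLp 2).1 (contDiffAt_partialD hF i) a

theorem contDiffAt_graphGram {f : EuclideanSpace ℝ (Fin n) → EuclideanSpace ℝ (Fin m)}
    {x : EuclideanSpace ℝ (Fin n)} (hf : ContDiffAt ℝ ∞ f x) (i j : Fin n) :
    ContDiffAt ℝ ∞ (fun y => graphGram (jacobian f y) i j) x := by
  simp only [graphGram, Matrix.add_apply, Matrix.mul_apply, Matrix.transpose_apply]
  exact contDiffAt_const.add (ContDiffAt.sum fun a _ =>
    (contDiffAt_jacobian hf a i).mul (contDiffAt_jacobian hf a j))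

/-- The second partial derivatives of the components of `f`. -/
def hess (f : EuclideanSpace ℝ (Fin n) → EuclideanSpace ℝ ι) (x : EuclideanSpace ℝ (Fin n))
    (a : ι) (i j : Fin n) : ℝ :=
  fderiv ℝ (fun y => jacobian f y a j) x (EuclideanSpace.single i 1)

theorem hess_symm {f : EuclideanSpace ℝ (Fin n) → EuclideanSpace ℝ ι}
    {x : EuclideanSpace ℝ (Fin n)} (hf : ContDiffAt ℝ ∞ f x) (a : ι) (i j : Fin n) :
    hess f x a i j = hess f x a j i := by
  have h : ∀ i j, hess f x a i j = (fderiv ℝ (fderiv ℝ f) x (EuclideanSpace.single i 1)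
      (EuclideanSpace.single j 1)) a := by
    intro i j
    have h1 : DifferentiableAt ℝ (fderiv ℝ f) x :=
      (hf.fderiv_right (m := ∞) (by simp)).differentiableAt (by simp)
    have h2 : DifferentiableAt ℝ (partialD f j) x :=
      (contDiffAt_partialD hf j).differentiableAt (by simp)
    change fderiv ℝ (fun y => partialD f j y a) x _ = _
    rw [← fderiv_apply_coord h2]
    have h3 := (h1.hasFDerivAt.clm_apply
      (hasFDerivAt_const (EuclideanSpace.single j (1 : ℝ)) x)).fderiv
    rw [ContinuousLinearMap.comp_zero, zero_add] at h3
    exact congrArg (fun L : EuclideanSpace ℝ (Fin n) →L[ℝ] EuclideanSpace ℝ ι =>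
      L (EuclideanSpace.single i 1) a) h3
  rw [h, h]
  exact congrArg (fun v : EuclideanSpace ℝ ι => v a)
    ((hf.isSymmSndFDerivAt (by simpa using ENat.LEInfty.out)).eq _ _)

/-- The vector `v = ∑ gⁱʲ ∂ᵢ∂ⱼ(x, f x)` has no normal part, so it is tangent. Its horizontal part is
zero because `x` is linear in itself, and a tangent vector of a graph is determined by its
horizontal part. Hence `v = 0`. -/
theorem IsMinimal.sum_inv_mul_hess {D : Set (EuclideanSpace ℝ (Fin n))} (hD : IsOpen D)
    {f : EuclideanSpace ℝ (Fin n) → EuclideanSpace ℝ (Fin m)} (hf : ContDiffOn ℝ ∞ f D)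
    (hmin : IsMinimal D (graphMap f)) {x : EuclideanSpace ℝ (Fin n)} (hx : x ∈ D) (a : Fin m) :
    ∑ i, ∑ j, (graphGram (jacobian f x))⁻¹ i j * hess f x a i j = 0 := by
  have hfa : ∀ y ∈ D, ContDiffAt ℝ ∞ f y := fun y hy => hf.contDiffAt (hD.mem_nhds hy)
  have hf1 : ∀ y ∈ D, ContDiffAt ℝ 1 f y := fun y hy => (hfa y hy).of_le (by simp)
  have h := hmin x hx
  simp only [meanCurvature, secondFundamentalForm, ← map_smul, ← map_sum] at h
  set v := ∑ i, ∑ j, (inducedMetric (graphMap f) x)⁻¹ i j •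
    partialD (partialD (graphMap f) j) i x with hv
  have hd : ∀ j, DifferentiableAt ℝ (partialD (graphMap f) j) x := fun j =>
    (contDiffAt_partialD (contDiffAt_graphMap (hfa x hx)) j).differentiableAt (by simp)
  have hl : ∀ i j k, partialD (partialD (graphMap f) j) i x (Sum.inl k) = 0 := by
    intro i j k
    rw [partialD, fderiv_apply_coord (hd j)]
    have : (fun y => partialD (graphMap f) j y (Sum.inl k)) =ᶠ[𝓝 x]
        fun _ => (EuclideanSpace.single j (1 : ℝ) : EuclideanSpace ℝ (Fin n)) k := by
      filter_upwards [hD.mem_nhds hx] with y hy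
      exact fderiv_graphMap_inl (hf1 y hy) _ k
    rw [this.fderiv_eq]
    simp
  have hr : ∀ i j, partialD (partialD (graphMap f) j) i x (Sum.inr a) = hess f x a i j := by
    intro i j
    rw [partialD, fderiv_apply_coord (hd j), hess]
    refine congrArg (fun L : EuclideanSpace ℝ (Fin n) →L[ℝ] ℝ => L (EuclideanSpace.single i 1))
      (EventuallyEq.fderiv_eq ?_)
    filter_upwards [hD.mem_nhds hx] with y hy
    exact fderiv_graphMap_inr (hf1 y hy) _ a
  have hmem : v ∈ tangentSpaceAt (graphMap f) x := by
    rw [Submodule.starProjection_apply_eq_zero_iff, normalSpaceAt,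
      Submodule.orthogonal_orthogonal] at h
    exact h
  obtain ⟨ξ, hξ⟩ := hmem
  have hξ0 : ξ = 0 := by
    ext k
    have h1 : v (Sum.inl k) = ξ k := by
      rw [← hξ]
      exact fderiv_graphMap_inl (hf1 x hx) ξ k
    rw [← h1, hv]
    simp [hl]
  have hv0 : v (Sum.inr a) = 0 := by
    rw [← hξ, hξ0]
    simp
  rw [hv, inducedMetric_graphMap (hf1 x hx)] at hv0
  simpa [hr] using hv0

theorem fderiv_det {E κ : Type*} [NormedAddCommGroup E] [NormedSpace ℝ E] [Fintype κ]
    [DecidableEq κ] {A : E → Matrix κ κ ℝ} {x : E} (hA : ∀ i j, ContDiffAt ℝ 1 (fun y => A y i j) x)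
    (hx : (A x).det ≠ 0) (v : E) :
    fderiv ℝ (fun y => (A y).det) x v =
      (A x).det * ((A x)⁻¹ * Matrix.of fun i j => fderiv ℝ (fun y => A y i j) x v).trace := by
  have hd : DifferentiableAt ℝ (fun y => (A y).det) x :=
    (contDiffAt_det hA).differentiableAt one_ne_zero
  have h1 : HasDerivAt (fun t : ℝ => (A (x + t • v)).det) (fderiv ℝ (fun y => (A y).det) x v) 0 :=
    hd.hasFDerivAt.hasLineDerivAt v
  have h2 := hasDerivAt_det' (A := fun t : ℝ => A (x + t • v)) (t := 0)
    (A' := Matrix.of fun i j => fderiv ℝ (fun y => A y i j) x v)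
    (fun i j => ((hA i j).differentiableAt one_ne_zero).hasFDerivAt.hasLineDerivAt v)
    (by simpa using hx)
  simpa using h1.unique h2

/-- The derivative of the area integrand `√det (1 + PᵀP)` at `P = df`. -/
def areaFlux (f : EuclideanSpace ℝ (Fin n) → EuclideanSpace ℝ (Fin m))
    (x : EuclideanSpace ℝ (Fin n)) : Matrix (Fin m) (Fin n) ℝ :=
  √(graphGram (jacobian f x)).det • (jacobian f x * (graphGram (jacobian f x))⁻¹)

theorem contDiffAt_sqrt_det_graphGram {f : EuclideanSpace ℝ (Fin n) → EuclideanSpace ℝ (Fin m)}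
    {x : EuclideanSpace ℝ (Fin n)} (hf : ContDiffAt ℝ ∞ f x) :
    ContDiffAt ℝ ∞ (fun y => √(graphGram (jacobian f y)).det) x :=
  (contDiffAt_det (contDiffAt_graphGram hf)).sqrt (graphGram_det_pos _).ne'

theorem contDiffAt_areaFlux {f : EuclideanSpace ℝ (Fin n) → EuclideanSpace ℝ (Fin m)}
    {x : EuclideanSpace ℝ (Fin n)} (hf : ContDiffAt ℝ ∞ f x) (a : Fin m) (i : Fin n) :
    ContDiffAt ℝ ∞ (fun y => areaFlux f y a i) x := by
  simp only [areaFlux, Matrix.smul_apply, Matrix.mul_apply, smul_eq_mul]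
  exact (contDiffAt_sqrt_det_graphGram hf).mul (ContDiffAt.sum fun j _ =>
    (contDiffAt_jacobian hf a j).mul
      (contDiffAt_matrix_inv (contDiffAt_graphGram hf) (graphGram_det_pos _).ne' j i))

/-- The minimal surface system in divergence form. -/
theorem IsMinimal.sum_fderiv_areaFlux {D : Set (EuclideanSpace ℝ (Fin n))} (hD : IsOpen D)
    {f : EuclideanSpace ℝ (Fin n) → EuclideanSpace ℝ (Fin m)} (hf : ContDiffOn ℝ ∞ f D)
    (hmin : IsMinimal D (graphMap f)) {x : EuclideanSpace ℝ (Fin n)} (hx : x ∈ D) (a : Fin m) :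
    ∑ i, fderiv ℝ (fun y => areaFlux f y a i) x (EuclideanSpace.single i 1) = 0 := by
  have hfx : ContDiffAt ℝ ∞ f x := hf.contDiffAt (hD.mem_nhds hx)
  set J := jacobian f x with hJ
  set G := graphGram J with hG
  set w := √G.det with hw
  have hGdet : 0 < G.det := graphGram_det_pos J
  have hwpos : 0 < w := Real.sqrt_pos.2 hGdet
  have hne : (∞ : WithTop ℕ∞) ≠ 0 := by simp
  let C : EuclideanSpace ℝ (Fin n) → Matrix (Fin n) (Fin n) ℝ := fun y =>
    √(graphGram (jacobian f y)).det • (graphGram (jacobian f y))⁻¹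
  have hCd : ∀ i j, DifferentiableAt ℝ (fun y => C y i j) x := fun i j =>
    ((contDiffAt_sqrt_det_graphGram hfx).mul (contDiffAt_matrix_inv (contDiffAt_graphGram hfx)
      hGdet.ne' i j)).differentiableAt hne
  have hJd : ∀ a j, DifferentiableAt ℝ (fun y => jacobian f y a j) x := fun a j =>
    (contDiffAt_jacobian hfx a j).differentiableAt hne
  have hGd : ∀ i j, DifferentiableAt ℝ (fun y => graphGram (jacobian f y) i j) x := fun i j =>
    (contDiffAt_graphGram hfx i j).differentiableAt hne
  let e : Fin n → EuclideanSpace ℝ (Fin n) := fun i => EuclideanSpace.single i 1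
  let dC : Fin n → Fin n → Fin n → ℝ := fun k i j => fderiv ℝ (fun y => C y i j) x (e k)
  have hCx : C x = w • G⁻¹ := rfl
  have hCsymm : ∀ i j, C x i j = C x j i := by
    intro i j
    have : (C x).transpose = C x := by
      rw [hCx, Matrix.transpose_smul, Matrix.transpose_nonsing_inv, hG, graphGram_transpose]
    exact congrFun (congrFun this j) i
  have hS : ∀ b, ∑ i, ∑ j, C x i j * hess f x b i j = 0 := by
    intro b
    have := hmin.sum_inv_mul_hess hD hf hx b
    calc ∑ i, ∑ j, C x i j * hess f x b i j
        = w * ∑ i, ∑ j, (graphGram (jacobian f x))⁻¹ i j * hess f x b i j := by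
          simp only [Finset.mul_sum, hCx, Matrix.smul_apply, smul_eq_mul, mul_assoc]; rfl
      _ = 0 := by rw [this, mul_zero]
  -- derivative of the metric
  have hdG : ∀ k i j, fderiv ℝ (fun y => graphGram (jacobian f y) i j) x (e k) =
      ∑ b, (hess f x b k i * J b j + J b i * hess f x b k j) := by
    intro k i j
    have : HasFDerivAt (fun y => (1 : Matrix (Fin n) (Fin n) ℝ) i j +
        ∑ b, jacobian f y b i * jacobian f y b j)
        (∑ b, (J b i • fderiv ℝ (fun y => jacobian f y b j) x +
          J b j • fderiv ℝ (fun y => jacobian f y b i) x)) x :=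
      HasFDerivAt.const_add _ (HasFDerivAt.fun_sum fun b _ =>
        (hJd b i).hasFDerivAt.mul (hJd b j).hasFDerivAt)
    refine (congrArg (fun L : EuclideanSpace ℝ (Fin n) →L[ℝ] ℝ => L (e k)) this.fderiv).trans ?_
    simp only [sum_apply, add_apply,
      smul_apply, smul_eq_mul]
    refine Finset.sum_congr rfl fun b _ => ?_
    simp only [hess, e]
    ring
  -- derivative of the density
  have hdw : ∀ k, fderiv ℝ (fun y => √(graphGram (jacobian f y)).det) x (e k) =
      ∑ i, ∑ j, C x i j * ∑ b, J b i * hess f x b k j := by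
    intro k
    have h1 := ((contDiffAt_det (contDiffAt_graphGram hfx)).differentiableAt hne).hasFDerivAt.sqrt
      hGdet.ne'
    rw [h1.fderiv, smul_apply, smul_eq_mul,
      fderiv_det (fun i j => (contDiffAt_graphGram hfx i j).of_le (by simp)) hGdet.ne' (e k)]
    have h2 : 1 / (2 * √(graphGram (jacobian f x)).det) *
        ((graphGram (jacobian f x)).det * ((graphGram (jacobian f x))⁻¹ *
          Matrix.of fun i j => fderiv ℝ (fun y => graphGram (jacobian f y) i j) x (e k)).trace) =
        2⁻¹ * (C x * Matrix.of fun i j =>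
          fderiv ℝ (fun y => graphGram (jacobian f y) i j) x (e k)).trace := by
      change 1 / (2 * w) * (G.det * (G⁻¹ * _).trace) = 2⁻¹ * ((w • G⁻¹) * _).trace
      rw [Matrix.smul_mul, Matrix.trace_smul, smul_eq_mul]
      have : G.det = w * w := (Real.mul_self_sqrt hGdet.le).symm
      rw [this]
      field_simp
    rw [h2]
    simp only [Matrix.trace, Matrix.diag_apply, Matrix.mul_apply, Matrix.of_apply, hdG,
      Finset.sum_add_distrib, mul_add]
    have h3 : ∑ i, ∑ j, C x i j * ∑ b, hess f x b k j * J b i =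
        ∑ i, ∑ j, C x i j * ∑ b, J b i * hess f x b k j := by
      simp only [mul_comm (J _ _)]
    have h4 : ∑ i, ∑ j, C x i j * ∑ b, J b j * hess f x b k i =
        ∑ i, ∑ j, C x i j * ∑ b, J b i * hess f x b k j := by
      rw [Finset.sum_comm]
      exact Finset.sum_congr rfl fun i _ => Finset.sum_congr rfl fun j _ => by rw [hCsymm]
    rw [h3, h4]
    ring
  -- product rule for `C * G = w • 1`
  have hCG : ∀ k i l, ∑ j, (dC k i j * G j l + C x i j *
      ∑ b, (hess f x b k j * J b l + J b j * hess f x b k l)) =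
      if i = l then ∑ i, ∑ j, C x i j * ∑ b, J b i * hess f x b k j else 0 := by
    intro k i l
    have h1 : HasFDerivAt (fun y => ∑ j, C y i j * graphGram (jacobian f y) j l)
        (∑ j, (C x i j • fderiv ℝ (fun y => graphGram (jacobian f y) j l) x +
          G j l • fderiv ℝ (fun y => C y i j) x)) x :=
      HasFDerivAt.fun_sum fun j _ => (hCd i j).hasFDerivAt.mul (hGd j l).hasFDerivAt
    have h2 : (fun y => ∑ j, C y i j * graphGram (jacobian f y) j l) = fun y =>
        if i = l then √(graphGram (jacobian f y)).det else 0 := by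
      funext y
      have : C y * graphGram (jacobian f y) = √(graphGram (jacobian f y)).det • 1 := by
        simp only [C, Matrix.smul_mul, graphGram_inv_mul]
      have := congrFun (congrFun this i) l
      rw [Matrix.mul_apply] at this
      rw [this]
      simp [Matrix.one_apply]
    rw [h2] at h1
    have h3 := congrArg (fun L : EuclideanSpace ℝ (Fin n) →L[ℝ] ℝ => L (e k)) h1.fderiv
    simp only [sum_apply, add_apply,
      smul_apply, smul_eq_mul, hdG] at h3
    rw [← hdw]
    have h4 : fderiv ℝ (fun y => if i = l then √(graphGram (jacobian f y)).det else 0) x (e k) =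
        if i = l then fderiv ℝ (fun y => √(graphGram (jacobian f y)).det) x (e k) else 0 := by
      split_ifs <;> simp
    rw [← h4, h3]
    refine Finset.sum_congr rfl fun j _ => ?_
    simp only [dC]
    ring
  -- The matrix `C = √det G · G⁻¹` is divergence free, i.e. the coordinates of `ℝⁿ` are harmonic on
  -- the graph. Contracting the derivative of `C G = √det G · 1` expresses `(div C) G` as the
  -- gradient of `√det G` minus two sums: one vanishes by minimality, and the other equals the
  -- gradient by symmetry of the Hessian. As `G` is invertible, `div C = 0`.
  have hc : (fun j => ∑ i, dC i i j) = 0 := by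
    refine Matrix.eq_zero_of_vecMul_eq_zero hGdet.ne' ?_
    funext l
    have h1 : ∑ i, ∑ j, dC i i j * G j l = (∑ i, ∑ j, C x i j * ∑ b, J b i * hess f x b l j) -
        ∑ i, ∑ j, C x i j * ∑ b, (hess f x b i j * J b l + J b j * hess f x b i l) := by
      rw [eq_sub_iff_add_eq, ← Finset.sum_add_distrib]
      simp only [← Finset.sum_add_distrib, hCG]
      simp
    have h2 : ∑ i, ∑ j, C x i j * ∑ b, hess f x b i j * J b l = 0 := by
      have : ∀ i j, C x i j * ∑ b, hess f x b i j * J b l =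
          ∑ b, J b l * (C x i j * hess f x b i j) := fun i j => by
        rw [Finset.mul_sum]
        exact Finset.sum_congr rfl fun b _ => by ring
      simp only [this]
      have h5 : ∀ i : Fin n, ∑ j, ∑ b, J b l * (C x i j * hess f x b i j) =
          ∑ b, ∑ j, J b l * (C x i j * hess f x b i j) := fun i => Finset.sum_comm
      simp only [h5]
      rw [Finset.sum_comm]
      refine Finset.sum_eq_zero fun b _ => ?_
      simp only [← Finset.mul_sum, hS, mul_zero]
    have h3 : ∑ i, ∑ j, C x i j * ∑ b, J b j * hess f x b i l =
        ∑ i, ∑ j, C x i j * ∑ b, J b i * hess f x b l j := by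
      rw [Finset.sum_comm]
      exact Finset.sum_congr rfl fun i _ => Finset.sum_congr rfl fun j _ => by
        rw [hCsymm]
        exact congrArg _ (Finset.sum_congr rfl fun b _ => by rw [hess_symm hfx])
    change ∑ j, (∑ i, dC i i j) * G j l = 0
    simp only [Finset.sum_mul]
    rw [Finset.sum_comm, h1]
    simp only [Finset.sum_add_distrib, mul_add, h2, h3]
    simp
  -- The flux is `J C`, so its divergence is `J · div C` plus the contraction of `C` with the
  -- Hessian, and both vanish.
  have hflux : ∀ i, fderiv ℝ (fun y => areaFlux f y a i) x (e i) =
      ∑ j, (J a j * dC i j i + C x j i * hess f x a i j) := by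
    intro i
    have h1 : HasFDerivAt (fun y => ∑ j, jacobian f y a j * C y j i)
        (∑ j, (J a j • fderiv ℝ (fun y => C y j i) x +
          C x j i • fderiv ℝ (fun y => jacobian f y a j) x)) x :=
      HasFDerivAt.fun_sum fun j _ => (hJd a j).hasFDerivAt.mul (hCd j i).hasFDerivAt
    have h2 : (fun y => areaFlux f y a i) = fun y => ∑ j, jacobian f y a j * C y j i := by
      funext y
      simp only [areaFlux, ← Matrix.mul_smul, Matrix.mul_apply, C]
    rw [h2, h1.fderiv]
    simp only [sum_apply, add_apply,
      smul_apply, smul_eq_mul]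
    rfl
  have hdCsymm : ∀ k i j, dC k i j = dC k j i := by
    intro k i j
    have : (fun y => C y i j) = fun y => C y j i := by
      funext y
      have : (C y).transpose = C y := by
        simp only [C, Matrix.transpose_smul, Matrix.transpose_nonsing_inv, graphGram_transpose]
      exact congrFun (congrFun this j) i
    simp only [dC, this]
  change ∑ i, fderiv ℝ (fun y => areaFlux f y a i) x (e i) = 0
  simp only [hflux, Finset.sum_add_distrib]
  have h1 : ∑ i, ∑ j, J a j * dC i j i = 0 := by
    rw [Finset.sum_comm]
    refine Finset.sum_eq_zero fun j _ => ?_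
    rw [← Finset.mul_sum]
    simp only [hdCsymm _ j]
    rw [congrFun hc j]
    simp
  have h2 : ∑ i, ∑ j, C x j i * hess f x a i j = 0 := by
    rw [← hS a]
    exact Finset.sum_congr rfl fun i _ => Finset.sum_congr rfl fun j _ => by rw [hCsymm]
  rw [h1, h2, add_zero]

end Jacobian

/-! ### Smooth dependence of the volume on the parameter, and the second derivative test. -/

section SecondDerivative

variable {n : ℕ} {ι : Type*} [Fintype ι]

theorem hasDerivAt_setIntegral {E : Type*} [TopologicalSpace E] [T2Space E]
    [MeasurableSpace E] [OpensMeasurableSpace E] {μ : Measure E}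
    [IsFiniteMeasureOnCompacts μ] {ρ ρ' : ℝ → E → ℝ} {I : Set ℝ} {D K : Set E} (hI : IsOpen I)
    (hK : IsCompact K) (hKD : K ⊆ D)
    (hρ : ContinuousOn (fun p : ℝ × E => ρ p.1 p.2) (I ×ˢ D))
    (hρ' : ContinuousOn (fun p : ℝ × E => ρ' p.1 p.2) (I ×ˢ D))
    (hd : ∀ s ∈ I, ∀ x ∈ D, HasDerivAt (fun s => ρ s x) (ρ' s x) s) {s : ℝ} (hs : s ∈ I) :
    HasDerivAt (fun s => ∫ x in K, ρ s x ∂μ) (∫ x in K, ρ' s x ∂μ) s := by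
  have hslice : ∀ {φ : ℝ → E → ℝ}, ContinuousOn (fun p : ℝ × E => φ p.1 p.2) (I ×ˢ D) →
      ∀ s ∈ I, ContinuousOn (φ s) K := fun {φ} h s hs =>
    h.comp (f := fun x => (s, x)) (by fun_prop) fun x hx => ⟨hs, hKD hx⟩
  obtain ⟨ε, hε, hεI⟩ := Metric.nhds_basis_closedBall.mem_iff.1 (hI.mem_nhds hs)
  obtain ⟨C, hC⟩ := ((isCompact_closedBall s ε).prod hK).exists_bound_of_continuousOn
    (hρ'.mono (prod_mono hεI hKD))
  refine (hasDerivAt_integral_of_dominated_loc_of_deriv_le (s := Metric.closedBall s ε)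
    (bound := fun _ => C) (Metric.closedBall_mem_nhds s hε) ?_ ?_ ?_ ?_ ?_ ?_).2
  · filter_upwards [hI.mem_nhds hs] with t ht
    exact (hslice hρ t ht).aestronglyMeasurable_of_isCompact hK hK.measurableSet
  · exact (hslice hρ s hs).integrableOn_compact hK
  · exact (hslice hρ' s hs).aestronglyMeasurable_of_isCompact hK hK.measurableSet
  · filter_upwards [ae_restrict_mem hK.measurableSet] with x hx t ht
    exact hC (t, x) ⟨ht, hx⟩
  · exact integrableOn_const hK.measure_ne_top
  · filter_upwards [ae_restrict_mem hK.measurableSet] with x hx t ht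
    exact hd t (hεI ht) x (hKD hx)

theorem inducedMetric_det_pos {F : EuclideanSpace ℝ (Fin n) → EuclideanSpace ℝ ι}
    {x : EuclideanSpace ℝ (Fin n)} (h : Function.Injective (fderiv ℝ F x)) :
    0 < (inducedMetric F x).det := by
  have hli : LinearIndependent ℝ fun i => partialD F i x := by
    have h1 := (EuclideanSpace.basisFun (Fin n) ℝ).toBasis.linearIndependent.map'
      (fderiv ℝ F x : EuclideanSpace ℝ (Fin n) →ₗ[ℝ] EuclideanSpace ℝ ι)
      (LinearMap.ker_eq_bot.2 h)
    have h2 : (fun i => partialD F i x) =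
        fderiv ℝ F x ∘ (EuclideanSpace.basisFun (Fin n) ℝ).toBasis := by
      funext i
      simp [partialD]
    rw [h2]
    exact h1
  exact (Matrix.posDef_gram_of_linearIndependent (𝕜 := ℝ) hli).det_pos

namespace IsNormalVariation

variable {D K : Set (EuclideanSpace ℝ (Fin n))}
  {F₀ : EuclideanSpace ℝ (Fin n) → EuclideanSpace ℝ ι} {δ : ℝ}
  {F : ℝ → EuclideanSpace ℝ (Fin n) → EuclideanSpace ℝ ι}

theorem contDiffAt_uncurry (hF : IsNormalVariation D F₀ K δ F) (hD : IsOpen D) {s : ℝ}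
    (hs : s ∈ Ioo (-δ) δ) {x : EuclideanSpace ℝ (Fin n)} (hx : x ∈ D) :
    ContDiffAt ℝ ∞ (fun p : ℝ × EuclideanSpace ℝ (Fin n) => F p.1 p.2) (s, x) :=
  hF.smooth.contDiffAt ((isOpen_Ioo.prod hD).mem_nhds ⟨hs, hx⟩)

theorem contDiffAt (hF : IsNormalVariation D F₀ K δ F) (hD : IsOpen D) {s : ℝ}
    (hs : s ∈ Ioo (-δ) δ) {x : EuclideanSpace ℝ (Fin n)} (hx : x ∈ D) :
    ContDiffAt ℝ ∞ (F s) x :=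
  (hF.contDiffAt_uncurry hD hs hx).comp x (f := fun y => (s, y))
    (contDiffAt_const.prodMk contDiffAt_id)

theorem fderiv_eq (hF : IsNormalVariation D F₀ K δ F) (hD : IsOpen D) {s : ℝ}
    (hs : s ∈ Ioo (-δ) δ) {x : EuclideanSpace ℝ (Fin n)} (hx : x ∈ D) :
    fderiv ℝ (F s) x = (fderiv ℝ (fun p : ℝ × EuclideanSpace ℝ (Fin n) => F p.1 p.2) (s, x)).comp
      (ContinuousLinearMap.inr ℝ ℝ (EuclideanSpace ℝ (Fin n))) := by
  have h1 := ((hF.contDiffAt_uncurry hD hs hx).differentiableAt (by simp)).hasFDerivAt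
  exact (h1.comp x (hasFDerivAt_prodMk_right s x)).fderiv

theorem continuousOn_fderiv (hF : IsNormalVariation D F₀ K δ F) (hD : IsOpen D) :
    ContinuousOn (fun p : ℝ × EuclideanSpace ℝ (Fin n) => fderiv ℝ (F p.1) p.2)
      (Ioo (-δ) δ ×ˢ D) := by
  have h : ContinuousOn (fun p : ℝ × EuclideanSpace ℝ (Fin n) =>
      (fderiv ℝ (fun p : ℝ × EuclideanSpace ℝ (Fin n) => F p.1 p.2) p).comp
        (ContinuousLinearMap.inr ℝ ℝ (EuclideanSpace ℝ (Fin n)))) (Ioo (-δ) δ ×ˢ D) :=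
    (hF.smooth.continuousOn_fderiv_of_isOpen (isOpen_Ioo.prod hD) (by simp)).clm_comp
      continuousOn_const
  exact h.congr fun p hp => hF.fderiv_eq hD hp.1 hp.2

theorem contDiffOn_volumeDensity (hF : IsNormalVariation D F₀ K δ F) (hD : IsOpen D) :
    ContDiffOn ℝ ∞ (fun p : ℝ × EuclideanSpace ℝ (Fin n) => volumeDensity (F p.1) p.2)
      (Ioo (-δ) δ ×ˢ D) := by
  have hpart : ∀ i, ContDiffOn ℝ ∞ (fun p : ℝ × EuclideanSpace ℝ (Fin n) =>
      partialD (F p.1) i p.2) (Ioo (-δ) δ ×ˢ D) := by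
    intro i
    have h : ContDiffOn ℝ ∞ (fun p : ℝ × EuclideanSpace ℝ (Fin n) =>
        fderiv ℝ (fun p : ℝ × EuclideanSpace ℝ (Fin n) => F p.1 p.2) p
          (0, EuclideanSpace.single i 1)) (Ioo (-δ) δ ×ˢ D) :=
      (hF.smooth.fderiv_of_isOpen (isOpen_Ioo.prod hD) (m := ∞) (by simp)).clm_apply
        contDiffOn_const
    refine h.congr fun p hp => ?_
    rw [partialD, hF.fderiv_eq hD hp.1 hp.2]
    rfl
  intro p hp
  have hnhds := (isOpen_Ioo.prod hD).mem_nhds hp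
  have hdet : ContDiffAt ℝ ∞ (fun p : ℝ × EuclideanSpace ℝ (Fin n) =>
      (inducedMetric (F p.1) p.2).det) p :=
    contDiffAt_det fun i j => ((hpart i).contDiffAt hnhds).inner ℝ ((hpart j).contDiffAt hnhds)
  exact (hdet.sqrt
    (inducedMetric_det_pos (hF.immersion p.1 hp.1 p.2 hp.2)).ne').contDiffWithinAt

theorem exists_hasSecondDerivAt (hF : IsNormalVariation D F₀ K δ F) (hD : IsOpen D)
    (hK : IsCompact K) (hKD : K ⊆ D) (hδ : 0 < δ) :
    ∃ a, HasSecondDerivAt (fun s => volumeOver K (F s)) a 0 := by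
  set I := Ioo (-δ) δ
  have hI : IsOpen I := isOpen_Ioo
  have h0 : (0 : ℝ) ∈ I := ⟨neg_lt_zero.2 hδ, hδ⟩
  -- One differentiation under the integral, returning an integrand that is again smooth, so that it
  -- can be applied twice.
  have key : ∀ φ : ℝ → EuclideanSpace ℝ (Fin n) → ℝ,
      ContDiffOn ℝ ∞ (fun p : ℝ × EuclideanSpace ℝ (Fin n) => φ p.1 p.2) (I ×ˢ D) →
      ∃ φ' : ℝ → EuclideanSpace ℝ (Fin n) → ℝ,
        ContDiffOn ℝ ∞ (fun p : ℝ × EuclideanSpace ℝ (Fin n) => φ' p.1 p.2) (I ×ˢ D) ∧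
        ∀ s ∈ I, HasDerivAt (fun s => ∫ x in K, φ s x) (∫ x in K, φ' s x) s := by
    intro φ hφ
    let φ' : ℝ → EuclideanSpace ℝ (Fin n) → ℝ := fun s x =>
      fderiv ℝ (fun p : ℝ × EuclideanSpace ℝ (Fin n) => φ p.1 p.2) (s, x) (1, 0)
    have hφ' : ContDiffOn ℝ ∞ (fun p : ℝ × EuclideanSpace ℝ (Fin n) => φ' p.1 p.2) (I ×ˢ D) :=
      (hφ.fderiv_of_isOpen (hI.prod hD) (m := ∞) (by simp)).clm_apply contDiffOn_const
    refine ⟨φ', hφ', fun s hs => hasDerivAt_setIntegral hI hK hKD hφ.continuousOn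
      hφ'.continuousOn (fun t ht x hx => ?_) hs⟩
    have h1 := ((hφ.contDiffAt ((hI.prod hD).mem_nhds
      (show (t, x) ∈ I ×ˢ D from ⟨ht, hx⟩))).differentiableAt (by simp)).hasFDerivAt
    exact (h1.comp t (hasFDerivAt_prodMk_left t x)).hasDerivAt
  obtain ⟨ρ', hρ', h1⟩ := key (fun s x => volumeDensity (F s) x) (hF.contDiffOn_volumeDensity hD)
  obtain ⟨ρ'', -, h2⟩ := key ρ' hρ'
  refine ⟨∫ x in K, ρ'' 0 x, ?_, ?_⟩
  · filter_upwards [hI.mem_nhds h0] with s hs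
    exact (h1 s hs).differentiableAt
  · refine (h2 0 h0).congr_of_eventuallyEq ?_
    filter_upwards [hI.mem_nhds h0] with s hs
    exact (h1 s hs).deriv

/-- Compactness makes joint continuity of the differential uniform over `K`. Off `K` the two maps
agree near each point, because `K` is closed. -/
theorem eventually_norm_fderiv_sub_le (hF : IsNormalVariation D F₀ K δ F) (hD : IsOpen D)
    (hK : IsCompact K) (hKD : K ⊆ D) (hδ : 0 < δ) {ε : ℝ} (hε : 0 < ε) :
    ∀ᶠ s in 𝓝 (0 : ℝ), s ∈ Ioo (-δ) δ ∧ ∀ x ∈ D, ‖fderiv ℝ (F s) x - fderiv ℝ F₀ x‖ ≤ ε := by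
  have h0 : (0 : ℝ) ∈ Ioo (-δ) δ := ⟨neg_lt_zero.2 hδ, hδ⟩
  have hinit : ∀ x ∈ D, fderiv ℝ (F 0) x = fderiv ℝ F₀ x := fun x hx =>
    EventuallyEq.fderiv_eq (by filter_upwards [hD.mem_nhds hx] with y hy using hF.initial y hy)
  have hcont : ContinuousOn (fun p : ℝ × EuclideanSpace ℝ (Fin n) =>
      ‖fderiv ℝ (F p.1) p.2 - fderiv ℝ (F 0) p.2‖) (Ioo (-δ) δ ×ˢ D) := by
    refine ((hF.continuousOn_fderiv hD).sub ((hF.continuousOn_fderiv hD).comp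
      (f := fun p : ℝ × EuclideanSpace ℝ (Fin n) => ((0 : ℝ), p.2)) (by fun_prop) ?_)).norm
    exact fun p hp => ⟨h0, hp.2⟩
  have hKev : ∀ᶠ s in 𝓝 (0 : ℝ), ∀ x ∈ K, ‖fderiv ℝ (F s) x - fderiv ℝ (F 0) x‖ < ε := by
    refine hK.eventually_forall_of_forall_eventually fun x hx => ?_
    refine (hcont.continuousAt ((isOpen_Ioo.prod hD).mem_nhds
      (show ((0 : ℝ), x) ∈ Ioo (-δ) δ ×ˢ D from ⟨h0, hKD hx⟩))).eventually_lt_const ?_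
    simpa using hε
  filter_upwards [hKev, isOpen_Ioo.mem_nhds h0] with s hs hsI
  refine ⟨hsI, fun x hx => ?_⟩
  by_cases hxK : x ∈ K
  · rw [← hinit x hx]
    exact (hs x hxK).le
  · have : F s =ᶠ[𝓝 x] F₀ := by
      filter_upwards [hD.mem_nhds hx, hK.isClosed.isOpen_compl.mem_nhds hxK] with y hy hyK
      exact hF.fixed_outside s hsI y ⟨hy, hyK⟩
    rw [this.fderiv_eq, sub_self, norm_zero]
    exact hε.le

end IsNormalVariation

/-- If `a < 0`, the second derivative test makes `s₀` a local maximum as well. Then `A` is constant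
near `s₀`, which forces `a = 0`. -/
theorem HasSecondDerivAt.nonneg_of_isLocalMin {A : ℝ → ℝ} {a s₀ : ℝ}
    (hA : HasSecondDerivAt A a s₀) (hmin : IsLocalMin A s₀) : 0 ≤ a := by
  by_contra! ha
  have hd2 : deriv (deriv A) s₀ = a := hA.2.deriv
  have hmax : IsLocalMax A s₀ := isLocalMax_of_deriv_deriv_neg (hd2 ▸ ha) hmin.deriv_eq_zero
    hA.1.self_of_nhds.continuousAt
  have hconst : A =ᶠ[𝓝 s₀] fun _ => A s₀ := by
    filter_upwards [hmin, hmax] with s h1 h2 using le_antisymm h2 h1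
  have h1 : deriv (deriv A) s₀ = 0 := by
    rw [hconst.deriv.deriv_eq]
    simp
  linarith

end SecondDerivative

/-! ### Area of graphs: reparametrization, first variation and minimality among contractions. -/

section Competitor

variable {n m : ℕ} {ι : Type*} [Fintype ι]

theorem jacobian_mulVec (F : EuclideanSpace ℝ (Fin n) → EuclideanSpace ℝ ι)
    (x v : EuclideanSpace ℝ (Fin n)) :
    (jacobian F x).mulVec v.ofLp = (fderiv ℝ F x v).ofLp := by
  have hv : v = ∑ i, v i • EuclideanSpace.single i (1 : ℝ) := by
    simpa using ((EuclideanSpace.basisFun (Fin n) ℝ).sum_repr v).symm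
  funext a
  conv_rhs => rw [hv]
  simp [Matrix.mulVec, dotProduct, jacobian, partialD, mul_comm]

theorem isContr_jacobian {f : EuclideanSpace ℝ (Fin n) → EuclideanSpace ℝ (Fin m)}
    {x : EuclideanSpace ℝ (Fin n)} (h : ∀ v, ‖fderiv ℝ f x v‖ ≤ ‖v‖) :
    IsContr (jacobian f x) := by
  refine Matrix.PosSemidef.of_dotProduct_mulVec_nonneg ?_ fun v => ?_
  · exact Matrix.isHermitian_one.sub (by
      simpa using Matrix.isHermitian_conjTranspose_mul_self (jacobian f x))
  · have h1 := h (WithLp.toLp 2 v)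
    have h2 := jacobian_mulVec f x (WithLp.toLp 2 v)
    have h3 : ‖fderiv ℝ f x (WithLp.toLp 2 v)‖ ^ 2 ≤ ‖WithLp.toLp 2 v‖ ^ 2 := by gcongr
    rw [EuclideanSpace.real_norm_sq_eq, EuclideanSpace.real_norm_sq_eq, ← h2] at h3
    rw [star_trivial, Matrix.sub_mulVec, Matrix.one_mulVec, ← Matrix.mulVec_mulVec,
      dotProduct_sub, Matrix.dotProduct_mulVec, Matrix.vecMul_transpose]
    simpa [dotProduct, sq] using h3

theorem jacobian_comp {Φ : EuclideanSpace ℝ (Fin n) → EuclideanSpace ℝ (Fin n)}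
    {h : EuclideanSpace ℝ (Fin n) → EuclideanSpace ℝ ι} {x : EuclideanSpace ℝ (Fin n)}
    (hh : DifferentiableAt ℝ h (Φ x)) (hΦ : DifferentiableAt ℝ Φ x) :
    jacobian (h ∘ Φ) x = jacobian h (Φ x) * jacobian Φ x := by
  ext a i
  have h1 := congrFun (jacobian_mulVec h (Φ x) (partialD Φ i x)) a
  simp only [jacobian, Matrix.of_apply, partialD, Matrix.mul_apply] at h1 ⊢
  rw [fderiv_comp x hh hΦ, ContinuousLinearMap.comp_apply, ← h1]
  simp [Matrix.mulVec, dotProduct]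

theorem det_fderiv_eq_det_jacobian (Φ : EuclideanSpace ℝ (Fin n) → EuclideanSpace ℝ (Fin n))
    (x : EuclideanSpace ℝ (Fin n)) : (fderiv ℝ Φ x).det = (jacobian Φ x).det := by
  rw [ContinuousLinearMap.det,
    ← LinearMap.det_toMatrix (EuclideanSpace.basisFun (Fin n) ℝ).toBasis]
  congr 1

/-- The projection of `ℝⁿ⁺ᵐ` to the first `n` coordinates. -/
def fstL (n m : ℕ) : EuclideanSpace ℝ (Fin n ⊕ Fin m) →L[ℝ] EuclideanSpace ℝ (Fin n) :=
  LinearMap.mkContinuous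
    { toFun := fun v => WithLp.toLp 2 fun i => v (Sum.inl i)
      map_add' := fun _ _ => rfl
      map_smul' := fun _ _ => rfl } 1 fun v => by
    rw [one_mul]
    refine (sq_le_sq₀ (norm_nonneg _) (norm_nonneg _)).1 ?_
    rw [EuclideanSpace.real_norm_sq_eq, EuclideanSpace.real_norm_sq_eq, Fintype.sum_sum_type]
    exact le_add_of_nonneg_right (Finset.sum_nonneg fun _ _ => sq_nonneg _)

/-- The projection of `ℝⁿ⁺ᵐ` to the last `m` coordinates. -/
def sndL (n m : ℕ) : EuclideanSpace ℝ (Fin n ⊕ Fin m) →L[ℝ] EuclideanSpace ℝ (Fin m) :=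
  LinearMap.mkContinuous
    { toFun := fun v => WithLp.toLp 2 fun i => v (Sum.inr i)
      map_add' := fun _ _ => rfl
      map_smul' := fun _ _ => rfl } 1 fun v => by
    rw [one_mul]
    refine (sq_le_sq₀ (norm_nonneg _) (norm_nonneg _)).1 ?_
    rw [EuclideanSpace.real_norm_sq_eq, EuclideanSpace.real_norm_sq_eq, Fintype.sum_sum_type]
    exact le_add_of_nonneg_left (Finset.sum_nonneg fun _ _ => sq_nonneg _)

theorem norm_fstL_le : ‖fstL n m‖ ≤ 1 := LinearMap.mkContinuous_norm_le _ zero_le_one _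

theorem norm_sndL_le : ‖sndL n m‖ ≤ 1 := LinearMap.mkContinuous_norm_le _ zero_le_one _

theorem norm_fstL_apply_le (v : EuclideanSpace ℝ (Fin n ⊕ Fin m)) : ‖fstL n m v‖ ≤ ‖v‖ := by
  simpa using (fstL n m).le_of_opNorm_le norm_fstL_le v

theorem norm_sndL_apply_le (v : EuclideanSpace ℝ (Fin n ⊕ Fin m)) : ‖sndL n m v‖ ≤ ‖v‖ := by
  simpa using (sndL n m).le_of_opNorm_le norm_sndL_le v

theorem fstL_graphMap (f : EuclideanSpace ℝ (Fin n) → EuclideanSpace ℝ (Fin m))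
    (x : EuclideanSpace ℝ (Fin n)) : fstL n m (graphMap f x) = x := rfl

theorem sndL_graphMap (f : EuclideanSpace ℝ (Fin n) → EuclideanSpace ℝ (Fin m))
    (x : EuclideanSpace ℝ (Fin n)) : sndL n m (graphMap f x) = f x := rfl

theorem volumeDensity_graphMap {f : EuclideanSpace ℝ (Fin n) → EuclideanSpace ℝ (Fin m)}
    {x : EuclideanSpace ℝ (Fin n)} (hf : ContDiffAt ℝ 1 f x) :
    volumeDensity (graphMap f) x = √(graphGram (jacobian f x)).det := by
  rw [volumeDensity, inducedMetric_graphMap hf]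

/-- The volume density of a reparametrized graph. -/
theorem volumeDensity_eq_abs_det_mul
    {G : EuclideanSpace ℝ (Fin n) → EuclideanSpace ℝ (Fin n ⊕ Fin m)}
    {Φ : EuclideanSpace ℝ (Fin n) → EuclideanSpace ℝ (Fin n)}
    {h : EuclideanSpace ℝ (Fin n) → EuclideanSpace ℝ (Fin m)} {x : EuclideanSpace ℝ (Fin n)}
    (hG : DifferentiableAt ℝ G x) (hΦ : DifferentiableAt ℝ Φ x)
    (hh : DifferentiableAt ℝ h (Φ x)) (h1 : ∀ᶠ y in 𝓝 x, fstL n m (G y) = Φ y)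
    (h2 : ∀ᶠ y in 𝓝 x, sndL n m (G y) = h (Φ y)) :
    volumeDensity G x = |(fderiv ℝ Φ x).det| * √(graphGram (jacobian h (Φ x))).det := by
  have e1 : fderiv ℝ Φ x = (fstL n m).comp (fderiv ℝ G x) := by
    rw [← EventuallyEq.fderiv_eq h1]
    exact ((fstL n m).hasFDerivAt.comp x hG.hasFDerivAt).fderiv
  have e2 : fderiv ℝ (h ∘ Φ) x = (sndL n m).comp (fderiv ℝ G x) := by
    rw [← EventuallyEq.fderiv_eq (f := h ∘ Φ) h2]
    exact ((sndL n m).hasFDerivAt.comp x hG.hasFDerivAt).fderiv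
  have e3 : inducedMetric G x = (jacobian Φ x).transpose * graphGram (jacobian h (Φ x)) *
      jacobian Φ x := by
    have : inducedMetric G x = (jacobian Φ x).transpose * jacobian Φ x +
        (jacobian (h ∘ Φ) x).transpose * jacobian (h ∘ Φ) x := by
      rw [inducedMetric_eq_transpose_mul]
      ext i j
      simp only [Matrix.mul_apply, Matrix.add_apply, Fintype.sum_sum_type,
        Matrix.transpose_apply, jacobian, Matrix.of_apply, partialD, e1, e2]
      rfl
    rw [this, jacobian_comp hh hΦ, graphGram, Matrix.transpose_mul]
    simp only [Matrix.mul_add, Matrix.add_mul, Matrix.mul_assoc, Matrix.one_mul]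
  rw [volumeDensity, e3, Matrix.det_mul, Matrix.det_mul, Matrix.det_transpose,
    det_fderiv_eq_det_jacobian, mul_right_comm, Real.sqrt_mul (mul_self_nonneg _),
    Real.sqrt_mul_self_eq_abs]

section Extension

variable {E W : Type*} [NormedAddCommGroup E] [NormedSpace ℝ E] [NormedAddCommGroup W]
  [NormedSpace ℝ W] {D K : Set E} {φ : E → W}

theorem indicator_eventuallyEq (hD : IsOpen D) (h0 : ∀ x ∈ D \ K, φ x = 0) {x : E} (hx : x ∈ D) :
    K.indicator φ =ᶠ[𝓝 x] φ := by
  filter_upwards [hD.mem_nhds hx] with y hy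
  by_cases hyK : y ∈ K
  · exact indicator_of_mem hyK φ
  · rw [indicator_of_notMem hyK, h0 y ⟨hy, hyK⟩]

theorem indicator_eventuallyEq_zero (hK : IsClosed K) {x : E} (hx : x ∉ K) :
    K.indicator φ =ᶠ[𝓝 x] fun _ => 0 := by
  filter_upwards [hK.isOpen_compl.mem_nhds hx] with y hy
  exact indicator_of_notMem hy φ

/-- Extension by zero is smooth because the open sets `D` and `Kᶜ` cover the space: the extension
equals `φ` on the first and `0` on the second. -/
theorem contDiff_indicator {k : WithTop ℕ∞} (hD : IsOpen D) (hK : IsClosed K) (hKD : K ⊆ D)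
    (hφ : ∀ x ∈ D, ContDiffAt ℝ k φ x) (h0 : ∀ x ∈ D \ K, φ x = 0) :
    ContDiff ℝ k (K.indicator φ) := by
  rw [contDiff_iff_contDiffAt]
  intro x
  by_cases hx : x ∈ K
  · exact (hφ x (hKD hx)).congr_of_eventuallyEq (indicator_eventuallyEq hD h0 (hKD hx))
  · exact contDiffAt_const.congr_of_eventuallyEq (indicator_eventuallyEq_zero hK hx)

end Extension

theorem integral_fderiv_eq_zero_of_hasCompactSupport {b : EuclideanSpace ℝ (Fin n) → ℝ}
    (hb : ContDiff ℝ 1 b) (hs : HasCompactSupport b) (v : EuclideanSpace ℝ (Fin n)) :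
    ∫ x, fderiv ℝ b x v = 0 := by
  -- Integration by parts against the constant 1; only the products have to be integrable.
  have h := integral_mul_fderiv_eq_neg_fderiv_mul_of_integrable (μ := volume)
    (f := fun _ : EuclideanSpace ℝ (Fin n) => (1 : ℝ)) (g := b) (v := v) (by simp) ?_ ?_
    (fun x _ => differentiableAt_const _) (fun x _ => (hb.differentiable one_ne_zero) x)
  · simpa using h
  · simp only [one_mul]
    refine ((hb.continuous_fderiv one_ne_zero).clm_apply
      continuous_const).integrable_of_hasCompactSupport ?_
    exact (hs.fderiv (𝕜 := ℝ)).comp_left (g := fun L : EuclideanSpace ℝ (Fin n) →L[ℝ] ℝ => L v) rfl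
  · simpa using hb.continuous.integrable_of_hasCompactSupport hs

/-- The first variation of the area of a minimal graph vanishes. -/
theorem IsMinimal.setIntegral_areaFlux_mul {D K : Set (EuclideanSpace ℝ (Fin n))} (hD : IsOpen D)
    (hK : IsCompact K) (hKD : K ⊆ D)
    {f : EuclideanSpace ℝ (Fin n) → EuclideanSpace ℝ (Fin m)} (hf : ContDiffOn ℝ ∞ f D)
    (hmin : IsMinimal D (graphMap f)) {g : EuclideanSpace ℝ (Fin n) → EuclideanSpace ℝ (Fin m)}
    (hg : ∀ x ∈ D, ContDiffAt ℝ ∞ g x) (hg0 : ∀ x ∈ D \ K, g x = 0) :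
    ∫ x in K, ∑ i, ∑ a, areaFlux f x a i * jacobian g x a i = 0 := by
  have hfa : ∀ y ∈ D, ContDiffAt ℝ ∞ f y := fun y hy => hf.contDiffAt (hD.mem_nhds hy)
  have hne : (∞ : WithTop ℕ∞) ≠ 0 := by simp
  let φ : Fin n → EuclideanSpace ℝ (Fin n) → ℝ := fun i x => ∑ a, areaFlux f x a i * g x a
  have hga : ∀ x ∈ D, ∀ a, ContDiffAt ℝ ∞ (fun y => g y a) x := fun x hx a =>
    (contDiffAt_piLp 2).1 (hg x hx) a
  have hφ : ∀ i, ∀ x ∈ D, ContDiffAt ℝ 1 (φ i) x := fun i x hx =>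
    (ContDiffAt.sum fun a _ => (contDiffAt_areaFlux (hfa x hx) a i).mul (hga x hx a)).of_le
      (by simp)
  have hφ0 : ∀ i, ∀ x ∈ D \ K, φ i x = 0 := fun i x hx => by simp [φ, hg0 x hx]
  let b : Fin n → EuclideanSpace ℝ (Fin n) → ℝ := fun i => K.indicator (φ i)
  have hb : ∀ i, ContDiff ℝ 1 (b i) := fun i =>
    contDiff_indicator hD hK.isClosed hKD (hφ i) (hφ0 i)
  have hbs : ∀ i, HasCompactSupport (b i) := fun i =>
    HasCompactSupport.of_support_subset_isCompact hK support_indicator_subset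
  -- The integrand is the divergence of the flux contracted with `g`, since the flux itself is
  -- divergence free.
  have hdiv : ∀ x ∈ K, ∑ i, ∑ a, areaFlux f x a i * jacobian g x a i =
      ∑ i, fderiv ℝ (b i) x (EuclideanSpace.single i 1) := by
    intro x hxK
    have hx := hKD hxK
    have h1 : ∀ i, fderiv ℝ (b i) x (EuclideanSpace.single i 1) =
        ∑ a, (areaFlux f x a i * jacobian g x a i + g x a *
          fderiv ℝ (fun y => areaFlux f y a i) x (EuclideanSpace.single i 1)) := by
      intro i
      rw [(indicator_eventuallyEq hD (hφ0 i) hx).fderiv_eq]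
      have h2 : HasFDerivAt (φ i) (∑ a, (areaFlux f x a i • fderiv ℝ (fun y => g y a) x +
          g x a • fderiv ℝ (fun y => areaFlux f y a i) x)) x :=
        HasFDerivAt.fun_sum fun a _ =>
          ((contDiffAt_areaFlux (hfa x hx) a i).differentiableAt hne).hasFDerivAt.mul
            ((hga x hx a).differentiableAt hne).hasFDerivAt
      rw [h2.fderiv]
      simp only [sum_apply, add_apply, smul_apply, smul_eq_mul, jacobian, partialD,
        Matrix.of_apply, fderiv_apply_coord ((hg x hx).differentiableAt hne)]
    simp only [h1, Finset.sum_add_distrib]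
    have h3 : ∑ i, ∑ a, g x a *
        fderiv ℝ (fun y => areaFlux f y a i) x (EuclideanSpace.single i 1) = 0 := by
      rw [Finset.sum_comm]
      refine Finset.sum_eq_zero fun a _ => ?_
      rw [← Finset.mul_sum, hmin.sum_fderiv_areaFlux hD hf hx, mul_zero]
    rw [h3, add_zero]
  have hcont : ∀ i, Continuous fun x => fderiv ℝ (b i) x (EuclideanSpace.single i 1) := fun i =>
    ((hb i).continuous_fderiv one_ne_zero).clm_apply continuous_const
  rw [setIntegral_congr_fun hK.measurableSet hdiv, integral_finsetSum _ fun i _ =>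
    (hcont i).continuousOn.integrableOn_compact hK]
  refine Finset.sum_eq_zero fun i _ => ?_
  rw [setIntegral_eq_integral_of_forall_compl_eq_zero fun x hx => ?_]
  · exact integral_fderiv_eq_zero_of_hasCompactSupport (hb i) (hbs i) _
  · rw [(indicator_eventuallyEq_zero hK.isClosed hx).fderiv_eq]
    simp

/-- Among graphs of contractions with the same boundary values, a minimal one has least area. -/
theorem IsMinimal.setIntegral_area_le {D K : Set (EuclideanSpace ℝ (Fin n))} (hD : IsOpen D)
    (hK : IsCompact K) (hKD : K ⊆ D)
    {f : EuclideanSpace ℝ (Fin n) → EuclideanSpace ℝ (Fin m)} (hf : ContDiffOn ℝ ∞ f D)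
    (hmin : IsMinimal D (graphMap f)) {h : EuclideanSpace ℝ (Fin n) → EuclideanSpace ℝ (Fin m)}
    (hh : ∀ x ∈ D, ContDiffAt ℝ ∞ h x) (hhf : ∀ x ∈ D \ K, h x = f x)
    (hfc : ∀ x ∈ K, IsContr (jacobian f x)) (hhc : ∀ x ∈ K, IsContr (jacobian h x)) :
    ∫ x in K, √(graphGram (jacobian f x)).det ≤ ∫ x in K, √(graphGram (jacobian h x)).det := by
  have hfa : ∀ y ∈ D, ContDiffAt ℝ ∞ f y := fun y hy => hf.contDiffAt (hD.mem_nhds hy)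
  have hne : (∞ : WithTop ℕ∞) ≠ 0 := by simp
  have hgd : ∀ x ∈ D, ContDiffAt ℝ ∞ (fun y => h y - f y) x := fun x hx =>
    (hh x hx).sub (hfa x hx)
  have hzero := hmin.setIntegral_areaFlux_mul hD hK hKD hf (g := fun y => h y - f y) hgd
    fun x hx => sub_eq_zero.2 (hhf x hx)
  have hi1 : IntegrableOn (fun x => √(graphGram (jacobian f x)).det) K :=
    ContinuousOn.integrableOn_compact hK fun x hx =>
      (contDiffAt_sqrt_det_graphGram (hfa x (hKD hx))).continuousAt.continuousWithinAt
  have hi2 : IntegrableOn (fun x => √(graphGram (jacobian h x)).det) K :=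
    ContinuousOn.integrableOn_compact hK fun x hx =>
      (contDiffAt_sqrt_det_graphGram (hh x (hKD hx))).continuousAt.continuousWithinAt
  have hi3 : IntegrableOn (fun x => ∑ i, ∑ a, areaFlux f x a i *
      jacobian (fun y => h y - f y) x a i) K :=
    ContinuousOn.integrableOn_compact hK fun x hx =>
      (ContDiffAt.sum fun i _ => ContDiffAt.sum fun a _ =>
        (contDiffAt_areaFlux (hfa x (hKD hx)) a i).mul
          (contDiffAt_jacobian (hgd x (hKD hx)) a i)).continuousAt.continuousWithinAt
  -- The vanishing first variation in the direction `h - f` is added, which turns the claim into the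
  -- integrated tangent plane inequality.
  rw [← add_zero (∫ x in K, √(graphGram (jacobian f x)).det), ← hzero, ← integral_add hi1 hi3]
  refine setIntegral_mono_on (hi1.add hi3) hi2 hK.measurableSet fun x hx => ?_
  refine le_trans (le_of_eq ?_) ((hfc x hx).sqrt_det_graphGram_ge (hhc x hx))
  have hsub : jacobian (fun y => h y - f y) x = jacobian h x - jacobian f x := by
    ext a i
    have h1 := (((hh x (hKD hx)).differentiableAt hne).hasFDerivAt.sub
      ((hfa x (hKD hx)).differentiableAt hne).hasFDerivAt).fderiv
    simp only [jacobian, partialD, Matrix.of_apply, Matrix.sub_apply]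
    exact congrArg (fun L : EuclideanSpace ℝ (Fin n) →L[ℝ] EuclideanSpace ℝ (Fin m) =>
      L (EuclideanSpace.single i 1) a) h1
  rw [hsub, mul_add, mul_one]
  congr 1
  set J := jacobian f x with hJ
  have hT : ((graphGram J)⁻¹).transpose = (graphGram J)⁻¹ := by
    rw [Matrix.transpose_nonsing_inv, graphGram_transpose]
  have h1 : (graphGram J)⁻¹ * (J.transpose * (jacobian h x - J)) =
      (J * (graphGram J)⁻¹).transpose * (jacobian h x - J) := by
    rw [Matrix.transpose_mul, hT, Matrix.mul_assoc]
  have h2 : ((J * (graphGram J)⁻¹).transpose * (jacobian h x - J)).trace =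
      ∑ i, ∑ a, (J * (graphGram J)⁻¹) a i * (jacobian h x - J) a i := rfl
  rw [h1, h2]
  simp only [Finset.mul_sum, ← mul_assoc]
  rfl

end Competitor

/-! ### Nearby parametrized surfaces as graphs, and local minimality. -/

section Comparison

variable {n m : ℕ}

/-- A smooth perturbation of the identity with small derivative is a diffeomorphism. -/
theorem exists_homeomorph_of_norm_fderiv_le {E : Type*} [NormedAddCommGroup E] [NormedSpace ℝ E]
    [CompleteSpace E] {w : E → E} (hw : ContDiff ℝ ∞ w) {ε : ℝ} (hε : ε < 1)
    (hdw : ∀ x, ‖fderiv ℝ w x‖ ≤ ε) :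
    ∃ e : E ≃ₜ E, (∀ x, e x = x + w x) ∧ ContDiff ℝ ∞ e.symm := by
  have hε0 : 0 ≤ ε := (norm_nonneg _).trans (hdw 0)
  have hne : (∞ : WithTop ℕ∞) ≠ 0 := by simp
  have hlip : LipschitzWith ⟨ε, hε0⟩ w :=
    lipschitzWith_of_nnnorm_fderiv_le (hw.differentiable hne) fun x => hdw x
  have happ : ApproximatesLinearOn (fun x => x + w x)
      ((ContinuousLinearEquiv.refl ℝ E : E ≃L[ℝ] E) : E →L[ℝ] E) univ ⟨ε, hε0⟩ := by
    intro x _ y _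
    have h1 : x + w x - (y + w y) - (x - y) = w x - w y := by abel
    simpa [h1] using hlip.norm_sub_le x y
  have hc : Subsingleton E ∨
      (⟨ε, hε0⟩ : NNReal) < ‖((ContinuousLinearEquiv.refl ℝ E).symm : E →L[ℝ] E)‖₊⁻¹ := by
    rcases subsingleton_or_nontrivial E with h | h
    · exact Or.inl h
    · right
      have : ‖((ContinuousLinearEquiv.refl ℝ E).symm : E →L[ℝ] E)‖₊ = 1 :=
        NNReal.eq ContinuousLinearMap.norm_id
      rw [this, inv_one]
      exact hε
  let e := happ.toHomeomorph _ hc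
  have hex : ∀ x, e x = x + w x := fun _ => rfl
  refine ⟨e, hex, ?_⟩
  have hnorm : ∀ x, ‖-fderiv ℝ w x‖ < 1 := fun x => by
    rw [norm_neg]
    exact (hdw x).trans_lt hε
  -- The derivative `1 + dw` is invertible by the Neumann series, so the inverse of `e` is smooth.
  refine e.contDiff_symm (f₀' := fun x =>
    ContinuousLinearEquiv.unitsEquiv ℝ E (Units.oneSub (-fderiv ℝ w x) (hnorm x))) (fun x => ?_)
    (contDiff_id.add hw)
  have h1 := (hasFDerivAt_id x).add ((hw.differentiable hne) x).hasFDerivAt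
  refine h1.congr_fderiv ?_
  ext v
  simp

/-- Area comparison between a minimal graph with slopes at most `t` and a nearby parametrized
surface with the same boundary values. -/
theorem IsMinimal.volumeOver_le {D K : Set (EuclideanSpace ℝ (Fin n))} (hD : IsOpen D)
    (hK : IsCompact K) (hKD : K ⊆ D)
    {f : EuclideanSpace ℝ (Fin n) → EuclideanSpace ℝ (Fin m)} (hf : ContDiffOn ℝ ∞ f D)
    (hmin : IsMinimal D (graphMap f)) {t ε : ℝ} (hε : 0 < ε) (htε : t + 2 * ε ≤ 1) (ht : 0 ≤ t)
    (hdf : ∀ x ∈ D, ‖fderiv ℝ f x‖ ≤ t)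
    {G : EuclideanSpace ℝ (Fin n) → EuclideanSpace ℝ (Fin n ⊕ Fin m)}
    (hG : ∀ x ∈ D, ContDiffAt ℝ ∞ G x) (hG0 : ∀ x ∈ D \ K, G x = graphMap f x)
    (hdG : ∀ x ∈ D, ‖fderiv ℝ G x - fderiv ℝ (graphMap f) x‖ ≤ ε) :
    volumeOver K (graphMap f) ≤ volumeOver K G := by
  have hne : (∞ : WithTop ℕ∞) ≠ 0 := by simp
  have hfa : ∀ y ∈ D, ContDiffAt ℝ ∞ f y := fun y hy => hf.contDiffAt (hD.mem_nhds hy)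
  have hFd : ∀ y ∈ D, DifferentiableAt ℝ (graphMap f) y := fun y hy =>
    (contDiffAt_graphMap (hfa y hy)).differentiableAt hne
  have hGd : ∀ y ∈ D, DifferentiableAt ℝ G y := fun y hy => (hG y hy).differentiableAt hne
  -- the horizontal displacement
  let φ : EuclideanSpace ℝ (Fin n) → EuclideanSpace ℝ (Fin n) := fun x =>
    fstL n m (G x - graphMap f x)
  have hφ : ∀ x ∈ D, ContDiffAt ℝ ∞ φ x := fun x hx =>
    (fstL n m).contDiff.contDiffAt.comp x ((hG x hx).sub (contDiffAt_graphMap (hfa x hx)))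
  have hφ0 : ∀ x ∈ D \ K, φ x = 0 := fun x hx => by simp [φ, hG0 x hx]
  have hdφ : ∀ x ∈ D, ‖fderiv ℝ φ x‖ ≤ ε := by
    intro x hx
    have h1 : fderiv ℝ φ x = (fstL n m).comp (fderiv ℝ G x - fderiv ℝ (graphMap f) x) :=
      ((fstL n m).hasFDerivAt.comp x
        ((hGd x hx).hasFDerivAt.sub (hFd x hx).hasFDerivAt)).fderiv
    rw [h1]
    refine ((fstL n m).opNorm_comp_le _).trans ?_
    calc ‖fstL n m‖ * ‖fderiv ℝ G x - fderiv ℝ (graphMap f) x‖ ≤ 1 * ε :=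
          mul_le_mul norm_fstL_le (hdG x hx) (norm_nonneg _) zero_le_one
      _ = ε := one_mul ε
  have hw : ContDiff ℝ ∞ (K.indicator φ) := contDiff_indicator hD hK.isClosed hKD hφ hφ0
  have hdw : ∀ x, ‖fderiv ℝ (K.indicator φ) x‖ ≤ ε := by
    intro x
    by_cases hx : x ∈ K
    · rw [(indicator_eventuallyEq hD hφ0 (hKD hx)).fderiv_eq]
      exact hdφ x (hKD hx)
    · rw [(indicator_eventuallyEq_zero hK.isClosed hx).fderiv_eq]
      simpa using hε.le
  obtain ⟨e, he, hes⟩ := exists_homeomorph_of_norm_fderiv_le hw (by linarith) hdw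
  have heK : ∀ x, x ∉ K → e x = x := fun x hx => by rw [he, indicator_of_notMem hx, add_zero]
  -- If `e x` were outside `K` it would be fixed by `e`, and injectivity would give `e x = x ∈ K`.
  have hemaps : ∀ x ∈ K, e x ∈ K := fun x hx => by
    by_contra h
    exact h ((e.injective (heK _ h)).symm ▸ hx)
  have hesK : ∀ y, y ∉ K → e.symm y = y := fun y hy => by
    rw [e.symm_apply_eq, heK y hy]
  have hesmaps : ∀ y ∈ K, e.symm y ∈ K := fun y hy => by
    by_contra h
    have := heK _ h
    rw [e.apply_symm_apply] at this
    exact h (this ▸ hy)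
  have himage : e '' K = K := by
    refine Subset.antisymm (image_subset_iff.2 hemaps) fun y hy => ?_
    exact ⟨e.symm y, hesmaps y hy, e.apply_symm_apply y⟩
  have hesD : ∀ y ∈ D, e.symm y ∈ D := fun y hy => by
    by_cases h : y ∈ K
    · exact hKD (hesmaps y h)
    · rwa [hesK y h]
  have hed : Differentiable ℝ e := by
    have : (e : EuclideanSpace ℝ (Fin n) → EuclideanSpace ℝ (Fin n)) =
        fun x => x + K.indicator φ x := funext he
    rw [this]
    exact differentiable_id.add (hw.differentiable hne)
  have hefst : ∀ x ∈ D, e x = fstL n m (G x) := by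
    intro x hx
    rw [he, (indicator_eventuallyEq hD hφ0 hx).self_of_nhds]
    simp only [φ, map_sub, fstL_graphMap, add_sub_cancel]
  -- the competitor as a graph
  let h : EuclideanSpace ℝ (Fin n) → EuclideanSpace ℝ (Fin m) := fun y => sndL n m (G (e.symm y))
  have hh : ∀ y ∈ D, ContDiffAt ℝ ∞ h y := fun y hy =>
    (sndL n m).contDiff.contDiffAt.comp y ((hG _ (hesD y hy)).comp y hes.contDiffAt)
  have hhf : ∀ y ∈ D \ K, h y = f y := fun y hy => by
    simp only [h, hesK y hy.2, hG0 y hy, sndL_graphMap]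
  have hhe : ∀ x, h (e x) = sndL n m (G x) := fun x => by simp [h]
  have hhd : ∀ x ∈ K, DifferentiableAt ℝ h (e x) := fun x hx =>
    (hh _ (hKD (hemaps x hx))).differentiableAt hne
  have hfc : ∀ x ∈ K, IsContr (jacobian f x) := fun x hx => isContr_jacobian fun v => by
    refine ((fderiv ℝ f x).le_of_opNorm_le (hdf x (hKD hx)) v).trans ?_
    exact mul_le_of_le_one_left (norm_nonneg v) (by linarith)
  have hhc : ∀ y ∈ K, IsContr (jacobian h y) := by
    intro y hy
    obtain ⟨x, hx, rfl⟩ := himage.symm ▸ hy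
    have hxD := hKD hx
    refine isContr_jacobian fun v => ?_
    have hfe : fderiv ℝ e x = (fstL n m).comp (fderiv ℝ G x) := by
      have : e =ᶠ[𝓝 x] fun z => fstL n m (G z) := by
        filter_upwards [hD.mem_nhds hxD] with z hz using hefst z hz
      rw [this.fderiv_eq]
      exact ((fstL n m).hasFDerivAt.comp x (hGd x hxD).hasFDerivAt).fderiv
    have hfh : (fderiv ℝ h (e x)).comp (fderiv ℝ e x) = (sndL n m).comp (fderiv ℝ G x) := by
      rw [← fderiv_comp x (hhd x hx) (hed x)]
      have : h ∘ e = fun z => sndL n m (G z) := funext hhe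
      rw [this]
      exact ((sndL n m).hasFDerivAt.comp x (hGd x hxD).hasFDerivAt).fderiv
    -- The differential of `e` is onto, so the slope of `h` can be tested on vectors `de(u)`, where
    -- it compares the vertical and horizontal parts of `dG(u)`.
    obtain ⟨u, rfl⟩ : ∃ u, fderiv ℝ e x u = v := by
      refine ⟨fderiv ℝ e.symm (e x) v, ?_⟩
      have hsd : DifferentiableAt ℝ e.symm (e x) := (hes.differentiable hne) _
      have h2 : HasFDerivAt (e ∘ e.symm) ((fderiv ℝ e x).comp (fderiv ℝ e.symm (e x))) (e x) := by
        refine HasFDerivAt.comp (e x) ?_ hsd.hasFDerivAt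
        rw [e.symm_apply_apply]
        exact (hed x).hasFDerivAt
      have h3 : e ∘ e.symm = id := funext e.apply_symm_apply
      rw [h3] at h2
      exact congrArg (fun L : EuclideanSpace ℝ (Fin n) →L[ℝ] EuclideanSpace ℝ (Fin n) => L v)
        (h2.unique (hasFDerivAt_id _))
    have h4 : fderiv ℝ h (e x) (fderiv ℝ e x u) = sndL n m (fderiv ℝ G x u) :=
      congrArg (fun L : EuclideanSpace ℝ (Fin n) →L[ℝ] EuclideanSpace ℝ (Fin m) => L u) hfh
    have h5 : fderiv ℝ e x u = fstL n m (fderiv ℝ G x u) := by rw [hfe]; rfl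
    have hd1 : ‖fderiv ℝ G x u - fderiv ℝ (graphMap f) x u‖ ≤ ε * ‖u‖ :=
      (fderiv ℝ G x - fderiv ℝ (graphMap f) x).le_of_opNorm_le (hdG x hxD) u
    have hs : sndL n m (fderiv ℝ (graphMap f) x u) = fderiv ℝ f x u :=
      (congrArg (fun L : EuclideanSpace ℝ (Fin n) →L[ℝ] EuclideanSpace ℝ (Fin m) => L u)
        ((sndL n m).hasFDerivAt.comp x (hFd x hxD).hasFDerivAt).fderiv).symm
    have hfst : fstL n m (fderiv ℝ (graphMap f) x u) = u :=
      ((congrArg (fun L : EuclideanSpace ℝ (Fin n) →L[ℝ] EuclideanSpace ℝ (Fin n) => L u)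
        ((fstL n m).hasFDerivAt.comp x (hFd x hxD).hasFDerivAt).fderiv).symm).trans
          (congrArg (fun L : EuclideanSpace ℝ (Fin n) →L[ℝ] EuclideanSpace ℝ (Fin n) => L u)
            (hasFDerivAt_id x).fderiv)
    have b1 : ‖sndL n m (fderiv ℝ G x u)‖ ≤ t * ‖u‖ + ε * ‖u‖ := by
      have h6 : sndL n m (fderiv ℝ G x u) = fderiv ℝ f x u +
          sndL n m (fderiv ℝ G x u - fderiv ℝ (graphMap f) x u) := by
        rw [map_sub, hs, add_sub_cancel]
      rw [h6]
      exact (norm_add_le _ _).trans (add_le_add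
        ((fderiv ℝ f x).le_of_opNorm_le (hdf x hxD) u) ((norm_sndL_apply_le _).trans hd1))
    have b2 : ‖u‖ ≤ ‖fstL n m (fderiv ℝ G x u)‖ + ε * ‖u‖ := by
      have h6 : u = fstL n m (fderiv ℝ G x u) -
          fstL n m (fderiv ℝ G x u - fderiv ℝ (graphMap f) x u) := by
        rw [map_sub, hfst, sub_sub_cancel]
      calc ‖u‖ = ‖fstL n m (fderiv ℝ G x u) -
          fstL n m (fderiv ℝ G x u - fderiv ℝ (graphMap f) x u)‖ := congrArg _ h6
        _ ≤ _ := (norm_sub_le _ _).trans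
          (add_le_add le_rfl ((norm_fstL_apply_le _).trans hd1))
    rw [h4, h5]
    -- The vertical part is at most `(t + ε)‖u‖` and the horizontal part at least `(1 - ε)‖u‖`; `t +
    -- 2ε ≤ 1` is exactly what compares them.
    nlinarith [norm_nonneg u]
  -- comparison of the areas
  have hvol : volumeOver K G = ∫ y in K, √(graphGram (jacobian h y)).det := by
    have hcv := integral_image_eq_integral_abs_det_fderiv_smul volume hK.measurableSet
      (fun x _ => (hed x).hasFDerivAt.hasFDerivWithinAt) e.injective.injOn
      (fun y => √(graphGram (jacobian h y)).det)
    rw [himage] at hcv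
    rw [hcv, volumeOver]
    refine setIntegral_congr_fun hK.measurableSet fun x hx => ?_
    refine volumeDensity_eq_abs_det_mul (hGd x (hKD hx)) (hed x) (hhd x hx) ?_ ?_
    · filter_upwards [hD.mem_nhds (hKD hx)] with z hz using (hefst z hz).symm
    · exact Eventually.of_forall fun z => (hhe z).symm
  have hvol0 : volumeOver K (graphMap f) = ∫ y in K, √(graphGram (jacobian f y)).det :=
    setIntegral_congr_fun hK.measurableSet fun x hx =>
      volumeDensity_graphMap ((hfa x (hKD hx)).of_le (by simp))
  rw [hvol, hvol0]
  exact hmin.setIntegral_area_le hD hK hKD hf hh hhf hfc hhc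

theorem isStable_graphMap_of_norm_fderiv_le {D : Set (EuclideanSpace ℝ (Fin n))} (hD : IsOpen D)
    {f : EuclideanSpace ℝ (Fin n) → EuclideanSpace ℝ (Fin m)} (hf : ContDiffOn ℝ ∞ f D)
    (hmin : IsMinimal D (graphMap f)) {t : ℝ} (ht0 : 0 ≤ t) (ht1 : t < 1)
    (hdf : ∀ x ∈ D, ‖fderiv ℝ f x‖ ≤ t) : IsStable D (graphMap f) := by
  intro K hK hKD δ hδ F hF
  obtain ⟨a, ha⟩ := hF.exists_hasSecondDerivAt hD hK hKD hδ
  refine ⟨a, ha, ha.nonneg_of_isLocalMin ?_⟩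
  -- The largest `ε` with `t + 2ε ≤ 1`.
  have hε : 0 < (1 - t) / 2 := by linarith
  have hvol : volumeOver K (F 0) = volumeOver K (graphMap f) := by
    refine setIntegral_congr_fun hK.measurableSet fun x hx => ?_
    have : F 0 =ᶠ[𝓝 x] graphMap f := by
      filter_upwards [hD.mem_nhds (hKD hx)] with y hy using hF.initial y hy
    simp only [volumeDensity, inducedMetric, partialD, this.fderiv_eq]
  filter_upwards [hF.eventually_norm_fderiv_sub_le hD hK hKD hδ hε] with s hs
  rw [hvol]
  exact hmin.volumeOver_le hD hK hKD hf hε (by linarith) ht0 hdf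
    (fun x hx => hF.contDiffAt hD hs.1 hx) (hF.fixed_outside s hs.1) hs.2

end Comparison

end MinimalGraph
end

theorem theoremA (n m : ℕ) (D : Set (EuclideanSpace ℝ (Fin n))) (hD : IsOpen D)
    (f : EuclideanSpace ℝ (Fin n) → EuclideanSpace ℝ (Fin m)) (hf : ContDiffOn ℝ ∞ f D)
    (hmin : MinimalGraph.IsMinimal D (MinimalGraph.graphMap f))
    (hdf : ∀ x ∈ D, ‖fderiv ℝ f x‖ ≤
      (Real.sqrt (1 + MinimalGraph.stabilityConst n m) - 1) /
        Real.sqrt (MinimalGraph.stabilityConst n m)) :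
    MinimalGraph.IsStable D (MinimalGraph.graphMap f) := by
  set c := MinimalGraph.stabilityConst n m with hc
  have hcpos : 0 < c := by
    rw [hc, MinimalGraph.stabilityConst]
    split_ifs with h
    · exact one_pos
    · push Not at h
      have h1 : (2 : ℝ) < m := by exact_mod_cast h.1
      have h2 : (2 : ℝ) < n := by exact_mod_cast h.2
      exact lt_min (by linarith) (by linarith)
  have hs := Real.sqrt_pos.2 hcpos
  refine MinimalGraph.isStable_graphMap_of_norm_fderiv_le hD hf hmin ?_ ?_ hdf
  · exact div_nonneg (sub_nonneg.2 (Real.one_le_sqrt.2 (by linarith))) hs.le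
  -- The slope bound is below 1 because `1 + c < (1 + √c)²`.
  · rw [div_lt_one hs, sub_lt_iff_lt_add, Real.sqrt_lt' (by positivity)]
    nlinarith [Real.sq_sqrt hcpos.le]
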